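/- **Setting.** Let $\|\cdot\|$ be the Euclidean norm and the induced matrix norm; write unit quaternions as $Q=[q_0,\mathbf q^T]^T$ with Hamilton product $\otimes$ and $Q^{-1}=[q_0,-\mathbf q^T]^T$; let $G(Q)=q_0I+\mathbf q^\times$ and $R(Q)=I-2q_0\mathbf q^\times+2\mathbf q^\times\mathbf q^\times$. A rigid spacecraft with attitude $Q(t)$ and angular velocity $\omega(t)$, $t\ge 0$, obeys $$\dot Q=\tfrac12\begin{bmatrix}-\mathbf q^T\\ G(Q)\end{bmatrix}\omega,\qquad J\dot\omega=-\omega\times J\omega+DE(t)\tau_u+\tau_d ,$$ with $Q$ differentiable, $\omega$ locally absolutely continuous, and the second equation holding for almost every $t$. Here $J=J^T$ with $0<\lambda_l\le\lambda_{\min}(J)\le\lambda_{\max}(J)\le\lambda_r$; $D\in\mathbb R^{3\times m}$ has unit columns; $E=\mathrm{diag}(e_i(t))$ and its estimate $\hat E=\mathrm{diag}(\hat e_i(t))$ have entries in $[0,1]$; $\operatorname{rank}(DE)=\operatorname{rank}(D\hat E)=3$; and $H=D(E-\hat E)\hat E^2D^T(D\hat E^3D^T)^{-1}$ satisfies $\|H\|\le\rho_E$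 with $0\le\rho_E<1$. The estimates $\hat J=\hat J^T$, $\hat\tau_d$ satisfy $\|\hat J-J\|\le\rho_J$, $\|\hat\tau_d-\tau_d\|\le\rho_d$, $\|\hat\tau_d\|\le\hat\rho_d$. The desired attitude $Q_d$ obeys the same kinematics with $\omega_d$, where $\omega_d,\dot\omega_d$ are continuous, $\|\omega_d\|\le\rho_v$, $\|\dot\omega_d\|\le\rho_a$. All constants $\rho$ are nonnegative. An observer delivers $\hat Q$ (unit) and $\hat\omega$; the errors $\tilde Q=\hat Q^{-1}\otimes Q$ and $\tilde\omega=\hat\omega-\omega$ are continuous and bounded, $\limsup\|\tilde{\mathbf q}\|\le\rho_q<1$, $\limsup\|\tilde\omega\|\le\rho_w$ and $\limsup\tilde q_0\ge\sqrt{1-\rho_q^2}$. Put $Q_e=Q_d^{-1}\otimes Q$, $\omega_e=\omega-R(Q_e)\omega_d$, $s=\omega_e+k\mathbf q_e$, and $\hat Q_e=Q_d^{-1}\otimes\hat Q$, $\hat\omega_e=\hat\omega-R(\hat Q_e)\omega_d$, $\hat s=\hat\omega_e+k\hat{\mathbf q}_e$. **Controller.** $\tau_u=\hat E^2D^T(D\hat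 E^3D^T)^{-1}u$ with $u=-K\hat s+u_s+\hat\psi_d-\hat\psi-\hat\tau_d$, where, with $\hat v=R(\hat Q_e)\omega_d$, $$\hat\psi_d=\hat v^\times\hat J\hat v+\hat JR(\hat Q_e)\dot\omega_d,\quad \hat\psi=-\tfrac12k^2\hat{\mathbf q}_e^\times\hat J\hat{\mathbf q}_e+\tfrac12kG(\hat Q_e)\hat J\hat\omega_e-k\big[(\hat J\hat v)^\times-\hat v^\times\hat J-\hat J\hat v^\times\big]\hat{\mathbf q}_e,$$ $$u_s=-\frac{a_1(\|\hat{\mathbf q}_e\|+\gamma)+a_0}{\max\{\|\hat s\|,\varepsilon\}}\,\hat s .$$ The constants are $\rho_0=\sqrt{2(1-\sqrt{1-\rho_q^2})}$, $\rho_s=\rho_w+2\rho_q\rho_v+k\rho_0$, $a_3=\frac12k(\rho_0\|\hat J\|+\rho_J)$, $a_2=\frac12k^2\rho_J$, $a_1=k^2\rho_0\|\hat J\|+ka_3+3k\rho_v(\rho_J+2\rho_q\|\hat J\|)$, $$a_0=\tfrac12k^2\rho_0^2\|\hat J\|+\tfrac12k(\rho_w+2\rho_q\rho_v)\|\hat J\|+3k\rho_v\rho_0\|\hat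 J\|+4\rho_q\rho_v^2\|\hat J\|+2\rho_q\rho_a\|\hat J\|+\rho_J\rho_v^2+\rho_J\rho_a+\rho_d,$$ $b_3=\frac12k\|\hat J\|+\lambda_{\max}(K)$, $b_2=\frac12k^2\|\hat J\|$, $b_1=2b_2\rho_0+\frac12k^2\|\hat J\|+3k\rho_v\|\hat J\|+a_1$, $$b_0=b_2\rho_0^2+\tfrac12k(\rho_w+2\rho_q\rho_v)\|\hat J\|+3k\rho_v\rho_0\|\hat J\|+\lambda_{\max}(K)\rho_s+a_1(\rho_0+\gamma)+a_0+(\rho_v^2+\rho_a)\|\hat J\|+\hat\rho_d .$$ Assume $k>0$, $\gamma>0$, $K=K^T$ positive definite, $\varepsilon>\rho_s$, and $\kappa:=\lambda_{\min}(K)-a_3-\rho_Eb_3>0$. For $x\ge0$ let $$\phi_1(x,0)=(a_2+\rho_Eb_2)x^2+(2\varepsilon^{-1}a_1\rho_s+\rho_Eb_1)x+2\varepsilon^{-1}\rho_s[a_1(\gamma+\rho_0)+a_0]+\rho_Eb_0-(a_1\gamma-a_1\rho_0-\lambda_{\max}(K)\rho_s),$$ $$\phi_2(x,0)=(a_2+\rho_Eb_2)x^2+(\varepsilon^{-1}a_1\rho_s+a_1+\rho_Eb_1)x+\varepsilon^{-1}\rho_s[a_1(\gamma+\rho_0)+a_0]+a_0+\rho_Eb_0+\lambda_{\max}(K)\rho_s,$$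 and $\bar\phi=\max\{\phi_1,\phi_2\}$. Let $\bar q_0=1$ and, for $i\ge1$, $\bar s_i=\sqrt{\lambda_r/\lambda_l}\,\bar\phi(\bar q_{i-1},0)/\kappa$, $\bar q_i=\bar s_i/k$. **Statement.** Suppose $\bar q_1<1$. Then $\bar s_i\to\bar s_\infty$ and $\bar q_i\to\bar q_\infty$ for some real numbers $\bar s_\infty,\bar q_\infty$. Suppose moreover $\bar s_\infty+\rho_s<\varepsilon$, and set $\kappa'=\kappa+\varepsilon^{-1}(a_1\gamma+a_0)$, $\bar q'_0=\bar q_\infty$ and, for $i\ge1$, $\bar s'_i=\sqrt{\lambda_r/\lambda_l}\,\phi_2(\bar q'_{i-1},0)/\kappa'$, $\bar q'_i=\bar s'_i/k$. Then: 1. there is $T$ with $\|\hat s(t)\|<\varepsilon$ for all $t\ge T$; 2. for every $i\ge1$: $\limsup_{t\to\infty}\|s\|\le\bar s'_i$, $\limsup_{t\to\infty}\|\mathbf q_e\|\le\bar q'_i$, $\limsup_{t\to\infty}\|\omega_e\|\le2\bar s'_i$; 3. $(\bar q'_i)_{i\ge0}$ and $(\bar s'_i)_{i\ge1}$ are nonincreasing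 and converge to nonnegative limits $\bar q'_\infty,\bar s'_\infty$, for which the bounds in 2 also hold, and $\bar s'_i\le\bar s_j$, $\bar q'_i\le\bar q_j$ for all $i,j\ge1$; 4. if the uncertainties are nonzero in the sense that $\bar q_\infty>0$, $a_1\gamma+a_0>0$ (that is, $\kappa'>\kappa$), and $\rho_q,\rho_J,\rho_E$ are not all zero, then both sequences are strictly decreasing and strictly tighter: $\bar s'_i<\bar s_\infty$, $\bar q'_i<\bar q_\infty$, $\bar s'_i<\bar s_j$, $\bar q'_i<\bar q_j$ for all $i,j\ge1$. -/

import Mathlib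

open Filter Topology MeasureTheory
open scoped Matrix.Norms.L2Operator Matrix Quaternion

noncomputable section

namespace AttitudeTracking

/-! ### Vectors, matrices and unit quaternions

`‖·‖` is the Euclidean norm on `EuclideanSpace ℝ (Fin n)` and the induced 2-norm on matrices. -/

abbrev V3 := EuclideanSpace ℝ (Fin 3)

abbrev M3 := Matrix (Fin 3) (Fin 3) ℝ

/-- The matrix-vector product `A v` on Euclidean spaces. -/
abbrev act {a b : ℕ} (A : Matrix (Fin a) (Fin b) ℝ) (v : EuclideanSpace ℝ (Fin b)) :
    EuclideanSpace ℝ (Fin a) :=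
  Matrix.toEuclideanLin A v

infixr:73 " ⋆ᵥ " => act

/-- The smallest eigenvalue of a real symmetric matrix. -/
def lamMin (A : M3) : ℝ := sInf (spectrum ℝ A)

/-- The largest eigenvalue of a real symmetric matrix. -/
def lamMax (A : M3) : ℝ := sSup (spectrum ℝ A)

/-- The matrix `v^×` of the cross product with `v`. -/
def skew (v : V3) : M3 :=
  !![0, -v 2, v 1;
     v 2, 0, -v 0;
     -v 1, v 0, 0]

/-- The vector part of a quaternion. -/
def vec (q : ℍ[ℝ]) : V3 := !₂[q.imI, q.imJ, q.imK]

/-- The quaternion with given scalar and vector parts. -/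
def quat (a : ℝ) (v : V3) : ℍ[ℝ] := ⟨a, v 0, v 1, v 2⟩

/-- `G(q) = q₀ I + 𝐪^×`. -/
def G (q : ℍ[ℝ]) : M3 := q.re • (1 : M3) + skew (vec q)

/-- `R(q) = I - 2 q₀ 𝐪^× + 2 𝐪^× 𝐪^×`. -/
def R (q : ℍ[ℝ]) : M3 :=
  1 - (2 * q.re) • skew (vec q) + (2 : ℝ) • (skew (vec q) * skew (vec q))

/-- The right-hand side `½ [-𝐪ᵀ; G(q)] ω` of the attitude kinematics. -/
def kin (q : ℍ[ℝ]) (w : V3) : ℍ[ℝ] :=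
  quat (-(1 / 2) * inner ℝ (vec q) w) ((1 / 2 : ℝ) • (G q ⋆ᵥ w))

/-- `Ξ(J, w, v) = (J (w + v))^× - v^× J - J v^×`. -/
def Xi (J : M3) (w v : V3) : M3 := skew (J ⋆ᵥ (w + v)) - skew v * J - J * skew v

/-- `ψ` as a function of the gain, inertia, attitude error, rate error and `v = R(q) ω_d`. -/
def psi (k : ℝ) (J : M3) (q : ℍ[ℝ]) (w v : V3) : V3 :=
  -((1 / 2) * k ^ 2) • ((skew (vec q) * J) ⋆ᵥ vec q) + ((1 / 2) * k) • ((G q * J) ⋆ᵥ w)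
    - k • (Xi J 0 v ⋆ᵥ vec q)

/-- `ψ_d` as a function of the inertia, attitude error, `ω_d` and its time derivative. -/
def psid (J : M3) (q : ℍ[ℝ]) (wd wd' : V3) : V3 :=
  (skew (R q ⋆ᵥ wd) * J) ⋆ᵥ (R q ⋆ᵥ wd) + (J * R q) ⋆ᵥ wd'

/-! ### Design parameters, uncertainty bounds and the constants computed from them -/

/-- The quantities known to the designer: sliding gain `k`, boundary layer width `ε`, margin `γ`,
gain matrix `K`, inertia estimate `Ĵ` and the bounds on the uncertainties. -/
structure Params where
  k : ℝ
  ε : ℝ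
  γ : ℝ
  K : M3
  Jhat : M3
  ρq : ℝ
  ρw : ℝ
  ρE : ℝ
  ρJ : ℝ
  ρd : ℝ
  ρdhat : ℝ
  ρv : ℝ
  ρa : ℝ
  lamL : ℝ
  lamR : ℝ

namespace Params

variable (P : Params)

def ρ0 : ℝ := √(2 * (1 - √(1 - P.ρq ^ 2)))

def ρs : ℝ := P.ρw + 2 * P.ρq * P.ρv + P.k * P.ρ0

def a3 : ℝ := (1 / 2) * P.k * (P.ρ0 * ‖P.Jhat‖ + P.ρJ)

def a2 : ℝ := (1 / 2) * P.k ^ 2 * P.ρJ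

def a1 : ℝ :=
  P.k ^ 2 * P.ρ0 * ‖P.Jhat‖ + P.k * P.a3 + 3 * P.k * P.ρv * (P.ρJ + 2 * P.ρq * ‖P.Jhat‖)

def a0 : ℝ :=
  (1 / 2) * P.k ^ 2 * P.ρ0 ^ 2 * ‖P.Jhat‖ + (1 / 2) * P.k * (P.ρw + 2 * P.ρq * P.ρv) * ‖P.Jhat‖
    + 3 * P.k * P.ρv * P.ρ0 * ‖P.Jhat‖ + 4 * P.ρq * P.ρv ^ 2 * ‖P.Jhat‖
    + 2 * P.ρq * P.ρa * ‖P.Jhat‖ + P.ρJ * P.ρv ^ 2 + P.ρJ * P.ρa + P.ρd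

def b3 : ℝ := (1 / 2) * P.k * ‖P.Jhat‖ + lamMax P.K

def b2 : ℝ := (1 / 2) * P.k ^ 2 * ‖P.Jhat‖

def b1 : ℝ :=
  2 * P.b2 * P.ρ0 + (1 / 2) * P.k ^ 2 * ‖P.Jhat‖ + 3 * P.k * P.ρv * ‖P.Jhat‖ + P.a1

def b0 : ℝ :=
  P.b2 * P.ρ0 ^ 2 + (1 / 2) * P.k * (P.ρw + 2 * P.ρq * P.ρv) * ‖P.Jhat‖
    + 3 * P.k * P.ρv * P.ρ0 * ‖P.Jhat‖ + lamMax P.K * P.ρs + P.a1 * (P.ρ0 + P.γ) + P.a0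
    + (P.ρv ^ 2 + P.ρa) * ‖P.Jhat‖ + P.ρdhat

def κ : ℝ := lamMin P.K - P.a3 - P.ρE * P.b3

def φ1 (x y : ℝ) : ℝ :=
  (P.a2 + P.ρE * P.b2) * x ^ 2 + (2 * P.ε⁻¹ * P.a1 * (P.ρs + y) + P.ρE * P.b1) * x
    + 2 * P.ε⁻¹ * (P.ρs + y) * (P.a1 * (P.γ + P.ρ0 + y) + P.a0) + P.ρE * P.b0
    + (2 + lamMax P.K + P.a1) * y - (P.a1 * P.γ - P.a1 * P.ρ0 - lamMax P.K * P.ρs)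

def φ2 (x y : ℝ) : ℝ :=
  (P.a2 + P.ρE * P.b2) * x ^ 2 + (P.ε⁻¹ * P.a1 * (P.ρs + y) + P.a1 + P.ρE * P.b1) * x
    + P.ε⁻¹ * (P.ρs + y) * (P.a1 * (P.γ + P.ρ0 + y) + P.a0)
    + P.a0 + P.ρE * P.b0 + lamMax P.K * (P.ρs + y) + 2 * y

def φbar (x y : ℝ) : ℝ := max (P.φ1 x y) (P.φ2 x y)

/-- `√(λ_r/λ_l) φ̄(x, 0) / κ`. -/
def step (x : ℝ) : ℝ := √(P.lamR / P.lamL) * P.φbar x 0 / P.κ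

/-- `q̄_0 = 1`, `q̄_i = k⁻¹ s̄_i`. -/
def qbar : ℕ → ℝ
  | 0 => 1
  | i + 1 => P.k⁻¹ * P.step (qbar i)

/-- `s̄_i = √(λ_r/λ_l) φ̄(q̄_{i-1}, 0) / κ`, meaningful for `i ≥ 1`. -/
def sbar (i : ℕ) : ℝ := P.step (P.qbar (i - 1))

def κ' : ℝ := P.κ + P.ε⁻¹ * (P.a1 * P.γ + P.a0)

/-- `√(λ_r/λ_l) φ₂(x, 0) / κ'`. -/
def step' (x : ℝ) : ℝ := √(P.lamR / P.lamL) * P.φ2 x 0 / P.κ'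

/-- The refined sequence started at `q̄'_0 = x` with `q̄'_i = k⁻¹ s̄'_i`. -/
def qbar' (x : ℝ) : ℕ → ℝ
  | 0 => x
  | i + 1 => P.k⁻¹ * P.step' (qbar' x i)

/-- `s̄'_i = √(λ_r/λ_l) φ₂(q̄'_{i-1}, 0) / κ'` for `q̄'_0 = x`, meaningful for `i ≥ 1`. -/
def sbar' (x : ℝ) (i : ℕ) : ℝ := P.step' (P.qbar' x (i - 1))

/-- The sign conditions on the bounds and the gain conditions on the controller. -/
structure Valid : Prop where
  k_pos : 0 < P.k
  γ_pos : 0 < P.γ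
  K_posDef : P.K.PosDef
  Jhat_symm : P.Jhat.IsSymm
  ρq_nonneg : 0 ≤ P.ρq
  ρq_lt_one : P.ρq < 1
  ρw_nonneg : 0 ≤ P.ρw
  ρE_nonneg : 0 ≤ P.ρE
  ρE_lt_one : P.ρE < 1
  ρJ_nonneg : 0 ≤ P.ρJ
  ρd_nonneg : 0 ≤ P.ρd
  ρdhat_nonneg : 0 ≤ P.ρdhat
  ρv_nonneg : 0 ≤ P.ρv
  ρa_nonneg : 0 ≤ P.ρa
  lamL_pos : 0 < P.lamL
  lamL_le_lamR : P.lamL ≤ P.lamR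
  gain : P.a3 + P.ρE * (P.k * ‖P.Jhat‖ / 2 + lamMax P.K) < lamMin P.K
  ρs_lt_ε : P.ρs < P.ε

end Params

/-! ### The closed-loop system -/

/-- The plant data and all time signals: the true inertia `J`, the actuator distribution matrix `D`
of `m` thruster pairs, the health indicators `e` and their estimates `ehat`, the disturbance torque
and its estimate, the desired attitude `qd`, rate `wd` and acceleration `wd'`, the attitude `q`,
the angular velocity `w`, and the estimates `qhat`, `what` delivered by the observer. -/
structure Trajectory (m : ℕ) where
  J : M3
  D : Matrix (Fin 3) (Fin m) ℝ
  e : ℝ → Fin m → ℝ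
  ehat : ℝ → Fin m → ℝ
  τd : ℝ → V3
  τdhat : ℝ → V3
  qd : ℝ → ℍ[ℝ]
  wd : ℝ → V3
  wd' : ℝ → V3
  q : ℝ → ℍ[ℝ]
  w : ℝ → V3
  qhat : ℝ → ℍ[ℝ]
  what : ℝ → V3

namespace Trajectory

variable {m : ℕ} (X : Trajectory m) (P : Params) (t : ℝ)

/-! Inverses of unit quaternions are conjugates, written `star`. -/

/-- Attitude tracking error `q_e = q_d⁻¹ ⊗ q`. -/
def qe : ℍ[ℝ] := star (X.qd t) * X.q t

/-- Angular velocity tracking error `ω_e = ω - R(q_e) ω_d`. -/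
def we : V3 := X.w t - R (X.qe t) ⋆ᵥ X.wd t

/-- Sliding variable `s = ω_e + k 𝐪_e`. -/
def s : V3 := X.we t + P.k • vec (X.qe t)

/-- Attitude estimation error `q̃`, determined by `q̂ = q ⊗ q̃⁻¹`. -/
def qtil : ℍ[ℝ] := star (X.qhat t) * X.q t

/-- Angular velocity estimation error `ω̃`, determined by `ω̂ = ω + ω̃`. -/
def wtil : V3 := X.what t - X.w t

def qehat : ℍ[ℝ] := star (X.qd t) * X.qhat t

def wehat : V3 := X.what t - R (X.qehat t) ⋆ᵥ X.wd t

def shat : V3 := X.wehat t + P.k • vec (X.qehat t)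

def E : Matrix (Fin m) (Fin m) ℝ := Matrix.diagonal (X.e t)

def Ehat : Matrix (Fin m) (Fin m) ℝ := Matrix.diagonal (X.ehat t)

/-- `H = D Ẽ Ê² Dᵀ (D Ê³ Dᵀ)⁻¹` with `Ẽ = E - Ê`. -/
def H : M3 :=
  X.D * (X.E t - X.Ehat t) * X.Ehat t ^ 2 * X.Dᵀ * (X.D * X.Ehat t ^ 3 * X.Dᵀ)⁻¹

/-- The switching term `u_s`. -/
def us : V3 :=
  if P.ε ≤ ‖X.shat P t‖ then
    -((P.a1 * (‖vec (X.qehat t)‖ + P.γ) + P.a0) / ‖X.shat P t‖) • X.shat P t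
  else
    -((P.a1 * (‖vec (X.qehat t)‖ + P.γ) + P.a0) / P.ε) • X.shat P t

/-- The virtual control `u = -K ŝ + u_s + ψ̂_d - ψ̂ - τ̂_d`. -/
def u : V3 :=
  -(P.K ⋆ᵥ X.shat P t) + X.us P t + psid P.Jhat (X.qehat t) (X.wd t) (X.wd' t)
    - psi P.k P.Jhat (X.qehat t) (X.wehat t) (R (X.qehat t) ⋆ᵥ X.wd t) - X.τdhat t

/-- The command torque `τ_u = Ê² Dᵀ (D Ê³ Dᵀ)⁻¹ u`. -/
def τu : EuclideanSpace ℝ (Fin m) :=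
  (X.Ehat t ^ 2 * X.Dᵀ * (X.D * X.Ehat t ^ 3 * X.Dᵀ)⁻¹) ⋆ᵥ X.u P t

/-- The control torque `τ_c = D E τ_u`. -/
def τc : V3 := (X.D * X.E t) ⋆ᵥ X.τu P t

end Trajectory

/-- `limsup_{t→∞} f t ≤ c`, including that `f` is eventually bounded above. -/
def LimsupLe (f : ℝ → ℝ) (c : ℝ) : Prop :=
  IsBoundedUnder (· ≤ ·) atTop f ∧ limsup f atTop ≤ c

/-- The standing assumptions on plant, reference, faults and observer, on the time axis `[0, ∞)`. -/
structure Assumptions {m : ℕ} (P : Params) (X : Trajectory m) : Prop where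
  -- inertia
  J_symm : X.J.IsSymm
  lamL_le : P.lamL ≤ lamMin X.J
  le_lamR : lamMax X.J ≤ P.lamR
  Jtil_le : ‖P.Jhat - X.J‖ ≤ P.ρJ
  -- actuators
  D_unit : ∀ i, ∑ j, X.D j i ^ 2 = 1
  e_mem : ∀ t, 0 ≤ t → ∀ i, X.e t i ∈ Set.Icc (0 : ℝ) 1
  ehat_mem : ∀ t, 0 ≤ t → ∀ i, X.ehat t i ∈ Set.Icc (0 : ℝ) 1
  rank_E : ∀ t, 0 ≤ t → (X.D * X.E t).rank = 3
  rank_Ehat : ∀ t, 0 ≤ t → (X.D * X.Ehat t).rank = 3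
  H_le : ∀ t, 0 ≤ t → ‖X.H t‖ ≤ P.ρE
  -- disturbances
  τdtil_le : ∀ t, 0 ≤ t → ‖X.τdhat t - X.τd t‖ ≤ P.ρd
  τdhat_le : ∀ t, 0 ≤ t → ‖X.τdhat t‖ ≤ P.ρdhat
  -- reference motion
  qd_unit : ∀ t, 0 ≤ t → ‖X.qd t‖ = 1
  qd_kin : ∀ t, 0 ≤ t → HasDerivWithinAt X.qd (kin (X.qd t) (X.wd t)) (Set.Ici 0) t
  wd_deriv : ∀ t, 0 ≤ t → HasDerivWithinAt X.wd (X.wd' t) (Set.Ici 0) t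
  wd'_cont : ContinuousOn X.wd' (Set.Ici 0)
  wd_le : ∀ t, 0 ≤ t → ‖X.wd t‖ ≤ P.ρv
  wd'_le : ∀ t, 0 ≤ t → ‖X.wd' t‖ ≤ P.ρa
  -- observer
  qhat_unit : ∀ t, 0 ≤ t → ‖X.qhat t‖ = 1
  qtil_cont : ContinuousOn X.qtil (Set.Ici 0)
  wtil_cont : ContinuousOn X.wtil (Set.Ici 0)
  wtil_bdd : ∃ C, ∀ t, 0 ≤ t → ‖X.wtil t‖ ≤ C
  qtil_limsup : LimsupLe (fun t => ‖vec (X.qtil t)‖) P.ρq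
  wtil_limsup : LimsupLe (fun t => ‖X.wtil t‖) P.ρw
  qtil0_limsup : √(1 - P.ρq ^ 2) ≤ limsup (fun t => (X.qtil t).re) atTop

/-- `(q, ω)` solves the attitude kinematics and Euler's equation under the control law on `[0, ∞)`.
Health indicators and disturbances may be discontinuous in time, so `ω` is only required to be
locally absolutely continuous and to satisfy Euler's equation for almost every time. -/
structure IsClosedLoop {m : ℕ} (P : Params) (X : Trajectory m) : Prop where
  q_unit : ∀ t, 0 ≤ t → ‖X.q t‖ = 1
  q_kin : ∀ t, 0 ≤ t → HasDerivWithinAt X.q (kin (X.q t) (X.w t)) (Set.Ici 0) t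
  w_ac : ∀ T, 0 < T → AbsolutelyContinuousOnInterval X.w 0 T
  w_dyn : ∀ᵐ t ∂volume, 0 < t → ∃ w' : V3, HasDerivAt X.w w' t ∧
    X.J ⋆ᵥ w' = -(skew (X.w t) ⋆ᵥ (X.J ⋆ᵥ X.w t)) + X.τc P t + X.τd t

/-- `s`, the vector part of `q_e`, and `ω_e` are ultimately bounded by `c`, `c'`, `2 c`. -/
def ErrorBounds {m : ℕ} (P : Params) (X : Trajectory m) (c c' : ℝ) : Prop :=
  LimsupLe (fun t => ‖X.s P t‖) c ∧ LimsupLe (fun t => ‖vec (X.qe t)‖) c' ∧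
    LimsupLe (fun t => ‖X.we t‖) (2 * c)

end AttitudeTracking

end

/-!
The sliding variable `s = ω_e + k 𝐪_e` turns attitude tracking into a scalar comparison problem.
Since `Ξ(J, ω_e, v)` and `𝐪^× J + J 𝐪^×` are skew-symmetric, the power `sᵀ J ṡ` is
`sᵀ (ψ - ψ_d + τ_c + τ_d)` (`inner_closed_loop`, `Trajectory.deriv_energy`), and the fault-tolerant
allocation delivers `τ_c = u + H u` (`Trajectory.τc_eq`). Bounding the effect of every estimation
error gives a dissipation estimate `sᵀ J ṡ ≤ -κ ‖s‖² + φ̄(x, 0) ‖s‖` while `‖𝐪_e‖ ≤ x`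
(`Trajectory.Accurate.power_le`); within the boundary layer `‖ŝ‖ < ε` the switching term is a linear
damping, so that `κ` improves to `κ'` and `φ̄` to `φ₂` (`Trajectory.Accurate.power_le_of_lt`).

The observer errors obey their ultimate bounds only in the limit. At a finite time the estimates
hold for the parameters `P.relax δ`, in which these bounds are enlarged by `δ`, up to the mismatch
`P.slack δ` of the switching gains, and `δ → 0` by continuity.

The energy `sᵀ J s` is absolutely continuous, so the dissipation estimate yields the ultimate bound
`√(λ_r/λ_l) φ̄(x, 0) / κ` for `‖s‖` (`Trajectory.limsupLe_s`). An ultimate bound `σ < k` for `‖s‖`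
yields the bound `σ / k` for `‖𝐪_e‖`: the scalar part of `q_e` increases at a definite rate while
`‖𝐪_e‖` is larger, so it finally stays close to `1` or close to `-1` (`Trajectory.limsupLe_qe`,
`eventually_le_abs`). Starting from `‖𝐪_e‖ ≤ 1` and alternating the two steps produces the sequences
`s̄_i`, `q̄_i`. They decrease because the recursion is monotone and `q̄_1 < q̄_0`; their limit is a
fixed point. If it puts the trajectory into the boundary layer, the sharper recursion starts from
this fixed point and decreases again, since `κ' ≥ κ` and `φ₂ ≤ φ̄`. It is strictly decreasing when
`κ' > κ` and the polynomial `φ₂` is not constant, which holds as soon as an uncertainty is present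
because `J ≠ 0` excludes `Ĵ = 0` and `ρ_J = 0` at once.
-/

namespace AttitudeTracking

/-! ### Coordinates, the cross product and quaternion multiplication -/

lemma act_apply (A : M3) (v : V3) (i : Fin 3) :
    (A ⋆ᵥ v) i = A i 0 * v 0 + A i 1 * v 1 + A i 2 * v 2 := by
  simp [act, Matrix.mulVec, dotProduct, Fin.sum_univ_three]

lemma inner_eq (v w : V3) : inner ℝ v w = v 0 * w 0 + v 1 * w 1 + v 2 * w 2 := by
  simp [PiLp.inner_apply, Fin.sum_univ_three]; ring

lemma norm_sq_eq (v : V3) : ‖v‖ ^ 2 = v 0 ^ 2 + v 1 ^ 2 + v 2 ^ 2 := by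
  rw [EuclideanSpace.norm_sq_eq, Fin.sum_univ_three]; simp

lemma quat_norm_sq (q : ℍ[ℝ]) : ‖q‖ ^ 2 = q.re ^ 2 + ‖vec q‖ ^ 2 := by
  rw [norm_sq_eq, sq ‖q‖, ← Quaternion.normSq_eq_norm_mul_self, Quaternion.normSq_def']
  simp [vec]; ring

lemma act_mul {a b c : ℕ} (A : Matrix (Fin a) (Fin b) ℝ) (B : Matrix (Fin b) (Fin c) ℝ)
    (v : EuclideanSpace ℝ (Fin c)) : (A * B) ⋆ᵥ v = A ⋆ᵥ (B ⋆ᵥ v) := by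
  simp [act, Matrix.toLpLin_apply, Matrix.mulVec_mulVec]

lemma act_one (v : V3) : (1 : M3) ⋆ᵥ v = v := by simp [act]

lemma add_act {a b : ℕ} (A B : Matrix (Fin a) (Fin b) ℝ) (v : EuclideanSpace ℝ (Fin b)) :
    (A + B) ⋆ᵥ v = A ⋆ᵥ v + B ⋆ᵥ v := by simp [act]

lemma sub_act {a b : ℕ} (A B : Matrix (Fin a) (Fin b) ℝ) (v : EuclideanSpace ℝ (Fin b)) :
    (A - B) ⋆ᵥ v = A ⋆ᵥ v - B ⋆ᵥ v := by simp [act]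

lemma smul_act {a b : ℕ} (c : ℝ) (A : Matrix (Fin a) (Fin b) ℝ) (v : EuclideanSpace ℝ (Fin b)) :
    (c • A) ⋆ᵥ v = c • A ⋆ᵥ v := by simp [act]

lemma norm_act_le (A : M3) (v : V3) : ‖A ⋆ᵥ v‖ ≤ ‖A‖ * ‖v‖ := A.l2_opNorm_mulVec v

/-- Lagrange's identity for the cross product. -/
lemma norm_skew_act_sq (v w : V3) :
    ‖skew v ⋆ᵥ w‖ ^ 2 = ‖v‖ ^ 2 * ‖w‖ ^ 2 - (inner ℝ v w) ^ 2 := by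
  rw [norm_sq_eq, norm_sq_eq, norm_sq_eq, inner_eq]
  simp [act_apply, skew]; ring

lemma norm_skew_act_le (v w : V3) : ‖skew v ⋆ᵥ w‖ ≤ ‖v‖ * ‖w‖ := by
  apply le_of_sq_le_sq _ (by positivity)
  rw [norm_skew_act_sq]; nlinarith [sq_nonneg (inner ℝ v w : ℝ)]

lemma norm_G_act_le (q : ℍ[ℝ]) (w : V3) : ‖G q ⋆ᵥ w‖ ≤ ‖q‖ * ‖w‖ := by
  apply le_of_sq_le_sq _ (by positivity)
  have h : ‖G q ⋆ᵥ w‖ ^ 2 = q.re ^ 2 * ‖w‖ ^ 2 + ‖skew (vec q) ⋆ᵥ w‖ ^ 2 := by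
    rw [norm_sq_eq, norm_sq_eq, norm_sq_eq]
    simp [G, add_act, smul_act, act_one, act_apply, skew]; ring
  rw [h, mul_pow, quat_norm_sq, norm_skew_act_sq]; nlinarith [sq_nonneg (inner ℝ (vec q) w : ℝ)]

@[simp] lemma quat_re (a : ℝ) (v : V3) : (quat a v).re = a := rfl
@[simp] lemma quat_imI (a : ℝ) (v : V3) : (quat a v).imI = v 0 := rfl
@[simp] lemma quat_imJ (a : ℝ) (v : V3) : (quat a v).imJ = v 1 := rfl
@[simp] lemma quat_imK (a : ℝ) (v : V3) : (quat a v).imK = v 2 := rfl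
@[simp] lemma vec_zero (q : ℍ[ℝ]) : vec q 0 = q.imI := rfl
@[simp] lemma vec_one (q : ℍ[ℝ]) : vec q 1 = q.imJ := rfl
@[simp] lemma vec_two (q : ℍ[ℝ]) : vec q 2 = q.imK := rfl

lemma V3.ext {v w : V3} (h0 : v 0 = w 0) (h1 : v 1 = w 1) (h2 : v 2 = w 2) : v = w := by
  ext i; fin_cases i <;> assumption

/-- The attitude kinematics is `q̇ = ½ q ⊗ ω`. -/
lemma kin_eq (q : ℍ[ℝ]) (w : V3) : kin q w = (1 / 2 : ℝ) • (q * quat 0 w) := by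
  ext <;> simp [kin, inner_eq, act_apply, G, skew] <;> ring

lemma vec_quat (a : ℝ) (v : V3) : vec (quat a v) = v := V3.ext rfl rfl rfl

/-- For unit quaternions `R(q)` is the rotation `v ↦ q⁻¹ ⊗ v ⊗ q`. -/
lemma quat_R_act {q : ℍ[ℝ]} (hq : ‖q‖ = 1) (v : V3) :
    quat 0 (R q ⋆ᵥ v) = star q * quat 0 v * q := by
  have h : q.re ^ 2 + (q.imI ^ 2 + q.imJ ^ 2 + q.imK ^ 2) = 1 := by
    have := quat_norm_sq q
    rw [hq, norm_sq_eq] at this; simp at this; linarith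
  ext
  · simp; ring
  all_goals
    simp [R, add_act, sub_act, act_one, act_apply, skew]
  · linear_combination (- v 0) * h
  · linear_combination (- v 1) * h
  · linear_combination (- v 2) * h

lemma R_act_eq {q : ℍ[ℝ]} (hq : ‖q‖ = 1) (v : V3) : R q ⋆ᵥ v = vec (star q * quat 0 v * q) := by
  rw [← quat_R_act hq, vec_quat]

lemma norm_vec_le (q : ℍ[ℝ]) : ‖vec q‖ ≤ ‖q‖ := by
  apply le_of_sq_le_sq _ (by positivity)
  rw [quat_norm_sq]; nlinarith [sq_nonneg q.re]

lemma norm_quat_zero (v : V3) : ‖quat 0 v‖ = ‖v‖ := by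
  rw [← sq_eq_sq₀ (by positivity) (by positivity), quat_norm_sq, vec_quat]; simp

lemma norm_R_act {q : ℍ[ℝ]} (hq : ‖q‖ = 1) (v : V3) : ‖R q ⋆ᵥ v‖ = ‖v‖ := by
  rw [← norm_quat_zero, quat_R_act hq, norm_mul, norm_mul, norm_star, hq, norm_quat_zero]; ring

lemma self_mul_star_of_norm {q : ℍ[ℝ]} (hq : ‖q‖ = 1) : q * star q = 1 := by
  rw [Quaternion.self_mul_star, Quaternion.normSq_eq_norm_mul_self, hq]; simp

lemma R_mul_act {p q : ℍ[ℝ]} (hp : ‖p‖ = 1) (hq : ‖q‖ = 1) (v : V3) :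
    R (p * q) ⋆ᵥ v = R q ⋆ᵥ (R p ⋆ᵥ v) := by
  rw [R_act_eq (by simp [hp, hq]), R_act_eq hq, quat_R_act hp, star_mul]
  simp [mul_assoc]

/-- A rotation with vector part `𝐪` moves a vector `v` by at most `2 ‖𝐪‖ ‖v‖`. -/
lemma norm_sub_R_act_le {q : ℍ[ℝ]} (hq : ‖q‖ = 1) (v : V3) :
    ‖v - R q ⋆ᵥ v‖ ≤ 2 * ‖vec q‖ * ‖v‖ := by
  have h1 : v - R q ⋆ᵥ v = (2 : ℝ) • G (star q) ⋆ᵥ (skew (vec q) ⋆ᵥ v) := by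
    apply V3.ext <;>
    simp [R, G, add_act, sub_act, smul_act, act_one, act_apply, skew] <;> ring
  rw [h1, norm_smul]
  have h2 := norm_G_act_le (star q) (skew (vec q) ⋆ᵥ v)
  rw [norm_star, hq] at h2
  have h3 := norm_skew_act_le (vec q) v
  norm_num; linarith

/-- Both sides of the torque balance for `s` agree up to terms `M s` with `M` skew-symmetric, which
do not affect `sᵀ J ṡ`. -/
lemma inner_closed_loop {J : M3} (hJ : J.IsSymm) (k : ℝ) (q : ℍ[ℝ]) (we v a : V3) :
    inner ℝ (we + k • vec q)
      (-(skew (we + v) ⋆ᵥ (J ⋆ᵥ (we + v))) + J ⋆ᵥ (skew we ⋆ᵥ v) - J ⋆ᵥ a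
        + (k / 2) • J ⋆ᵥ (G q ⋆ᵥ we)) =
    inner ℝ (we + k • vec q) (psi k J q we v - ((skew v * J) ⋆ᵥ v + J ⋆ᵥ a)) := by
  have h1 := hJ.apply 0 1
  have h2 := hJ.apply 0 2
  have h3 := hJ.apply 1 2
  rw [inner_eq, inner_eq]
  simp only [psi, Xi, G, add_act, smul_act, act_one, sub_act, act_mul]
  simp [act_apply, skew, h1, h2, h3]; ring

lemma norm_Xi_act_le (J : M3) (v x : V3) : ‖Xi J 0 v ⋆ᵥ x‖ ≤ 3 * ‖J‖ * ‖v‖ * ‖x‖ := by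
  have e : Xi J 0 v ⋆ᵥ x = skew (J ⋆ᵥ v) ⋆ᵥ x - skew v ⋆ᵥ (J ⋆ᵥ x) - J ⋆ᵥ (skew v ⋆ᵥ x) := by
    simp only [Xi, sub_act, act_mul, zero_add]
  have h1 : ‖skew (J ⋆ᵥ v) ⋆ᵥ x‖ ≤ ‖J‖ * ‖v‖ * ‖x‖ :=
    (norm_skew_act_le _ _).trans (by gcongr; exact norm_act_le _ _)
  have h2 : ‖skew v ⋆ᵥ (J ⋆ᵥ x)‖ ≤ ‖v‖ * (‖J‖ * ‖x‖) :=
    (norm_skew_act_le _ _).trans (by gcongr; exact norm_act_le _ _)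
  have h3 : ‖J ⋆ᵥ (skew v ⋆ᵥ x)‖ ≤ ‖J‖ * (‖v‖ * ‖x‖) :=
    (norm_act_le _ _).trans (by gcongr; exact norm_skew_act_le _ _)
  rw [e]
  have h4 := norm_sub_le (skew (J ⋆ᵥ v) ⋆ᵥ x - skew v ⋆ᵥ (J ⋆ᵥ x)) (J ⋆ᵥ (skew v ⋆ᵥ x))
  have h5 := norm_sub_le (skew (J ⋆ᵥ v) ⋆ᵥ x) (skew v ⋆ᵥ (J ⋆ᵥ x))
  linarith

/-! ### Extreme eigenvalues of symmetric matrices -/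

lemma inner_act_nonneg {A : M3} (hA : A.PosSemidef) (v : V3) : 0 ≤ inner ℝ v (A ⋆ᵥ v) := by
  have h := hA.dotProduct_mulVec_nonneg v.ofLp
  simp only [dotProduct, Matrix.mulVec, Fin.sum_univ_three, Pi.star_apply, star_trivial] at h
  rw [inner_eq, act_apply, act_apply, act_apply]
  exact h

lemma inner_act_symm {A : M3} (hA : A.IsSymm) (v w : V3) :
    inner ℝ v (A ⋆ᵥ w) = inner ℝ (A ⋆ᵥ v) w := by
  have h1 := hA.apply 0 1
  have h2 := hA.apply 0 2
  have h3 := hA.apply 1 2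
  rw [inner_eq, inner_eq]
  simp only [act_apply, h1, h2, h3]; ring

lemma scalar_act (c : ℝ) (v : V3) : (algebraMap ℝ M3 c) ⋆ᵥ v = c • v := by
  rw [Algebra.algebraMap_eq_smul_one, smul_act, act_one]

lemma lamMin_mul_le {A : M3} (hA : A.IsSymm) (v : V3) :
    lamMin A * ‖v‖ ^ 2 ≤ inner ℝ v (A ⋆ᵥ v) := by
  have h : (A - algebraMap ℝ M3 (lamMin A)).PosSemidef := by
    rw [Matrix.posSemidef_iff_isHermitian_and_spectrum_nonneg]
    constructor
    · apply Matrix.IsHermitian.sub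
      · simpa [Matrix.IsHermitian] using hA.eq
      · rw [Algebra.algebraMap_eq_smul_one]
        simp [Matrix.IsHermitian]
    · rw [← spectrum.sub_singleton_eq]
      rintro _ ⟨x, hx, y, rfl, rfl⟩
      exact sub_nonneg.2 (csInf_le A.finite_real_spectrum.bddBelow hx)
  have h2 := inner_act_nonneg h v
  rw [sub_act, scalar_act, inner_sub_right, inner_smul_right, real_inner_self_eq_norm_sq] at h2
  linarith

lemma le_lamMax_mul {A : M3} (hA : A.IsSymm) (v : V3) :
    inner ℝ v (A ⋆ᵥ v) ≤ lamMax A * ‖v‖ ^ 2 := by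
  have h : (algebraMap ℝ M3 (lamMax A) - A).PosSemidef := by
    rw [Matrix.posSemidef_iff_isHermitian_and_spectrum_nonneg]
    constructor
    · apply Matrix.IsHermitian.sub
      · rw [Algebra.algebraMap_eq_smul_one]
        simp [Matrix.IsHermitian]
      · simpa [Matrix.IsHermitian] using hA.eq
    · rw [← spectrum.singleton_sub_eq]
      rintro _ ⟨y, rfl, x, hx, rfl⟩
      exact sub_nonneg.2 (le_csSup A.finite_real_spectrum.bddAbove hx)
  have h2 := inner_act_nonneg h v
  rw [sub_act, scalar_act, inner_sub_right, inner_smul_right, real_inner_self_eq_norm_sq] at h2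
  linarith

lemma isSymm_of_posDef {K : M3} (hK : K.PosDef) : K.IsSymm := by
  simpa [Matrix.IsSymm] using hK.isHermitian.eq

lemma lamMax_pos {K : M3} (hK : K.PosDef) : 0 < lamMax K := by
  have h1 := le_lamMax_mul (isSymm_of_posDef hK) (EuclideanSpace.single 0 1)
  have h2 := hK.diag_pos (i := 0)
  rw [inner_eq] at h1
  simp [act_apply] at h1
  linarith

lemma norm_act_le_lamMax {K : M3} (hK : K.PosDef) (v : V3) : ‖K ⋆ᵥ v‖ ≤ lamMax K * ‖v‖ := by
  set c := lamMax K
  have hc : 0 < c := lamMax_pos hK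
  set y := K ⋆ᵥ v with hy
  have hs := isSymm_of_posDef hK
  -- nonnegativity of the quadratic form at `c v - K v` bounds `‖K v‖²` by `c vᵀ K v`
  have h1 := inner_act_nonneg hK.posSemidef (c • v - y)
  have e : inner ℝ (c • v - y) (K ⋆ᵥ (c • v - y)) =
      c ^ 2 * inner ℝ v y - 2 * c * ‖y‖ ^ 2 + inner ℝ y (K ⋆ᵥ y) := by
    have e1 : K ⋆ᵥ (c • v - y) = c • y - K ⋆ᵥ y := by simp [hy, act]
    rw [e1, inner_sub_left, inner_sub_right, inner_sub_right, inner_smul_left, inner_smul_left,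
      inner_smul_right, inner_smul_right, inner_act_symm hs v y, ← hy, real_inner_self_eq_norm_sq]
    simp; ring
  have h2 := le_lamMax_mul hs y
  have h3 := real_inner_le_norm v y
  rw [e] at h1
  rcases (norm_nonneg y).eq_or_lt with h0 | h0
  · rw [← h0]; positivity
  · change _ ≤ c * _ at h2
    have h4 : c * ‖y‖ ^ 2 ≤ c * (c * (‖v‖ * ‖y‖)) := by nlinarith [mul_pos hc hc]
    have h5 := le_of_mul_le_mul_left h4 hc
    nlinarith

/-! ### Actuator allocation -/

lemma isUnit_allocation_det {m : ℕ} (D : Matrix (Fin 3) (Fin m) ℝ) {e : Fin m → ℝ}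
    (he : ∀ i, 0 ≤ e i) (hr : (D * Matrix.diagonal e).rank = 3) :
    IsUnit (D * Matrix.diagonal e ^ 3 * Dᵀ).det := by
  -- with `A = D √(Ê³)` the matrix is `A Aᵀ`, and `D Ê` factors through `A`
  set r : Fin m → ℝ := fun i => √(e i ^ 3)
  set A := D * Matrix.diagonal r with hA
  have h1 : D * Matrix.diagonal e ^ 3 * Dᵀ = A * Aᵀ := by
    rw [hA, Matrix.transpose_mul, Matrix.diagonal_transpose, Matrix.diagonal_pow]
    rw [Matrix.mul_assoc, Matrix.mul_assoc, ← Matrix.mul_assoc (Matrix.diagonal r),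
      Matrix.diagonal_mul_diagonal]
    congr 4
    ext i
    simp [r, Real.mul_self_sqrt (pow_nonneg (he i) 3)]
  have h2 : D * Matrix.diagonal e = A * Matrix.diagonal (fun i => e i / r i) := by
    rw [hA, Matrix.mul_assoc, Matrix.diagonal_mul_diagonal]
    congr 2
    ext i
    rcases (he i).eq_or_lt with h | h
    · simp [← h]
    · have : r i ≠ 0 := (Real.sqrt_pos.2 (pow_pos h 3)).ne'
      field_simp
  have h3 : A.rank = 3 := by
    apply le_antisymm (by simpa using A.rank_le_height)
    have h := Matrix.rank_mul_le_left A (Matrix.diagonal (fun i => e i / r i))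
    rwa [← h2, hr] at h
  rw [← Matrix.isUnit_iff_isUnit_det, ← Matrix.mulVec_surjective_iff_isUnit, h1]
  have h4 : (A * Aᵀ).rank = 3 := by rw [Matrix.rank_self_mul_transpose, h3]
  have h5 : LinearMap.range (A * Aᵀ).mulVecLin = ⊤ := by
    apply Submodule.eq_top_of_finrank_eq
    simpa [Matrix.rank] using h4
  exact LinearMap.range_eq_top.1 h5

namespace Trajectory

variable {m : ℕ} (X : Trajectory m) (P : Params) (t : ℝ)

/-- With the true health matrix the allocation delivers `u + H u`. -/
lemma τc_eq (he : ∀ i, 0 ≤ X.ehat t i) (hr : (X.D * X.Ehat t).rank = 3) :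
    X.τc P t = X.u P t + X.H t ⋆ᵥ X.u P t := by
  have hdet := isUnit_allocation_det X.D he hr
  have h1 : X.D * X.E t * (X.Ehat t ^ 2 * X.Dᵀ * (X.D * X.Ehat t ^ 3 * X.Dᵀ)⁻¹) = 1 + X.H t := by
    have h2 : X.D * X.E t * (X.Ehat t ^ 2 * X.Dᵀ * (X.D * X.Ehat t ^ 3 * X.Dᵀ)⁻¹) =
        (X.D * X.Ehat t ^ 3 * X.Dᵀ) * (X.D * X.Ehat t ^ 3 * X.Dᵀ)⁻¹ + X.H t := by
      simp only [H, pow_succ, pow_zero, Matrix.mul_sub, Matrix.sub_mul, Matrix.mul_assoc,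
        Matrix.one_mul]
      abel
    rw [h2]
    congr 1
    exact Matrix.mul_nonsing_inv _ hdet
  rw [τc, τu, ← act_mul, h1, add_act, act_one]

end Trajectory

/-! ### Effect of estimation errors on the compensation terms -/

lemma act_sub {a b : ℕ} (A : Matrix (Fin a) (Fin b) ℝ) (v w : EuclideanSpace ℝ (Fin b)) :
    A ⋆ᵥ (v - w) = A ⋆ᵥ v - A ⋆ᵥ w := map_sub _ _ _

lemma skew_sub (v w : V3) : skew (v - w) = skew v - skew w := by
  ext i j; fin_cases i <;> fin_cases j <;> simp [skew] <;> ring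

lemma vec_sub (p q : ℍ[ℝ]) : vec (p - q) = vec p - vec q := V3.ext (by simp) (by simp) (by simp)

lemma G_sub (p q : ℍ[ℝ]) : G (p - q) = G p - G q := by
  simp only [G, vec_sub, skew_sub, Quaternion.re_sub, sub_smul]; abel

lemma Xi_sub_left (J J' : M3) (v : V3) : Xi (J - J') 0 v = Xi J 0 v - Xi J' 0 v := by
  simp only [Xi, sub_act, skew_sub, Matrix.mul_sub, Matrix.sub_mul]; abel

lemma Xi_sub_right (J : M3) (v w : V3) : Xi J 0 (v - w) = Xi J 0 v - Xi J 0 w := by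
  simp only [Xi, zero_add, act_sub, skew_sub, Matrix.mul_sub, Matrix.sub_mul]; abel

lemma norm_star_mul {p q : ℍ[ℝ]} (hp : ‖p‖ = 1) (hq : ‖q‖ = 1) : ‖star p * q‖ = 1 := by
  rw [norm_mul, norm_star, hp, hq, one_mul]

lemma mul_star_mul {p : ℍ[ℝ]} (hp : ‖p‖ = 1) (q : ℍ[ℝ]) : p * (star p * q) = q := by
  rw [← mul_assoc, self_mul_star_of_norm hp, one_mul]

/-- The rotations of two unit quaternions differ by at most twice the norm of the vector part of the
quotient. -/
lemma norm_R_sub_R_act_le {p q : ℍ[ℝ]} (hp : ‖p‖ = 1) (hq : ‖q‖ = 1) (v : V3) :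
    ‖R p ⋆ᵥ v - R q ⋆ᵥ v‖ ≤ 2 * ‖vec (star p * q)‖ * ‖v‖ := by
  have h := norm_sub_R_act_le (norm_star_mul hp hq) (R p ⋆ᵥ v)
  rwa [← R_mul_act hp (norm_star_mul hp hq), mul_star_mul hp, norm_R_act hp] at h

/-- Two unit quaternions whose quotient has nonnegative scalar part and vector part of norm at most
`r` are at distance at most `√(2 (1 - √(1 - r²)))`. -/
lemma norm_sub_le_of_vec {p q : ℍ[ℝ]} (hp : ‖p‖ = 1) (hq : ‖q‖ = 1) {r : ℝ}
    (h0 : 0 ≤ (star p * q).re) (hr : ‖vec (star p * q)‖ ≤ r) :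
    ‖p - q‖ ≤ √(2 * (1 - √(1 - r ^ 2))) := by
  have hu := norm_star_mul hp hq
  have e : p - q = p * (1 - star p * q) := by rw [mul_sub, mul_star_mul hp, mul_one]
  rw [e, norm_mul, hp, one_mul]
  set z := star p * q
  apply Real.le_sqrt_of_sq_le
  have h1 := quat_norm_sq (1 - z)
  have h2 := quat_norm_sq z
  rw [hu] at h2
  have h3 : ‖vec (1 - z)‖ ^ 2 = ‖vec z‖ ^ 2 := by
    rw [norm_sq_eq, norm_sq_eq]; simp
  have h4 : √(1 - r ^ 2) ≤ z.re := by
    apply Real.sqrt_le_iff.2 ⟨h0, _⟩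
    nlinarith [norm_nonneg (vec z)]
  rw [h1, h3]
  simp only [Quaternion.re_sub, Quaternion.re_one]
  nlinarith

lemma norm_psid_le {q : ℍ[ℝ]} (hq : ‖q‖ = 1) (J : M3) {w w' : V3} {ρv ρa : ℝ}
    (hw : ‖w‖ ≤ ρv) (hw' : ‖w'‖ ≤ ρa) : ‖psid J q w w'‖ ≤ (ρv ^ 2 + ρa) * ‖J‖ := by
  have hv : ‖R q ⋆ᵥ w‖ ≤ ρv := by rwa [norm_R_act hq]
  have ha : ‖R q ⋆ᵥ w'‖ ≤ ρa := by rwa [norm_R_act hq]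
  rw [psid, act_mul, act_mul]
  have h1 : ‖skew (R q ⋆ᵥ w) ⋆ᵥ (J ⋆ᵥ (R q ⋆ᵥ w))‖ ≤ ρv * (‖J‖ * ρv) := by
    refine (norm_skew_act_le _ _).trans ?_
    have := norm_act_le J (R q ⋆ᵥ w)
    gcongr
    · exact (norm_nonneg _).trans hv
    · exact this.trans (by gcongr)
  have h2 : ‖J ⋆ᵥ (R q ⋆ᵥ w')‖ ≤ ‖J‖ * ρa := (norm_act_le _ _).trans (by gcongr)
  have := norm_add_le (skew (R q ⋆ᵥ w) ⋆ᵥ (J ⋆ᵥ (R q ⋆ᵥ w))) (J ⋆ᵥ (R q ⋆ᵥ w'))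
  linarith

lemma norm_psid_sub_le {p q : ℍ[ℝ]} (hp : ‖p‖ = 1) (hq : ‖q‖ = 1) (J J' : M3) {w w' : V3}
    {ρJ ρv ρa r : ℝ} (hJ : ‖J' - J‖ ≤ ρJ) (hw : ‖w‖ ≤ ρv) (hw' : ‖w'‖ ≤ ρa)
    (hr : ‖vec (star p * q)‖ ≤ r) :
    ‖psid J' p w w' - psid J q w w'‖ ≤
      4 * r * ρv ^ 2 * ‖J'‖ + 2 * r * ρa * ‖J'‖ + ρJ * ρv ^ 2 + ρJ * ρa := by
  have hv1 : ‖R p ⋆ᵥ w‖ ≤ ρv := by rwa [norm_R_act hp]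
  have hv2 : ‖R q ⋆ᵥ w‖ ≤ ρv := by rwa [norm_R_act hq]
  have ha2 : ‖R q ⋆ᵥ w'‖ ≤ ρa := by rwa [norm_R_act hq]
  have hρv : 0 ≤ ρv := (norm_nonneg _).trans hw
  have hr0 : 0 ≤ r := (norm_nonneg _).trans hr
  have hJ0 : 0 ≤ ρJ := (norm_nonneg _).trans hJ
  have hdv : ‖R p ⋆ᵥ w - R q ⋆ᵥ w‖ ≤ 2 * r * ρv :=
    (norm_R_sub_R_act_le hp hq w).trans (by gcongr)
  have hda : ‖R p ⋆ᵥ w' - R q ⋆ᵥ w'‖ ≤ 2 * r * ρa :=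
    (norm_R_sub_R_act_le hp hq w').trans (by gcongr)
  have e : psid J' p w w' - psid J q w w' =
      skew (R p ⋆ᵥ w - R q ⋆ᵥ w) ⋆ᵥ (J' ⋆ᵥ (R p ⋆ᵥ w))
      + skew (R q ⋆ᵥ w) ⋆ᵥ (J' ⋆ᵥ (R p ⋆ᵥ w - R q ⋆ᵥ w))
      + skew (R q ⋆ᵥ w) ⋆ᵥ ((J' - J) ⋆ᵥ (R q ⋆ᵥ w))
      + J' ⋆ᵥ (R p ⋆ᵥ w' - R q ⋆ᵥ w') + (J' - J) ⋆ᵥ (R q ⋆ᵥ w') := by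
    simp only [psid, act_mul, skew_sub, sub_act, act_sub]; abel
  have b (v : V3) (A : M3) (x : V3) : ‖skew v ⋆ᵥ (A ⋆ᵥ x)‖ ≤ ‖v‖ * (‖A‖ * ‖x‖) :=
    (norm_skew_act_le _ _).trans (by gcongr; exact norm_act_le _ _)
  have h1 : _ ≤ (2 * r * ρv) * (‖J'‖ * ρv) := (b (R p ⋆ᵥ w - R q ⋆ᵥ w) J' (R p ⋆ᵥ w)).trans
    (by gcongr)
  have h2 : _ ≤ ρv * (‖J'‖ * (2 * r * ρv)) := (b (R q ⋆ᵥ w) J' (R p ⋆ᵥ w - R q ⋆ᵥ w)).trans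
    (by gcongr)
  have h3 : _ ≤ ρv * (ρJ * ρv) := (b (R q ⋆ᵥ w) (J' - J) (R q ⋆ᵥ w)).trans (by gcongr)
  have h4 : _ ≤ ‖J'‖ * (2 * r * ρa) := (norm_act_le J' (R p ⋆ᵥ w' - R q ⋆ᵥ w')).trans
    (by gcongr)
  have h5 : _ ≤ ρJ * ρa := (norm_act_le (J' - J) (R q ⋆ᵥ w')).trans (by gcongr)
  rw [e]
  refine (norm_add_le_of_le (norm_add_le_of_le (norm_add_le_of_le (norm_add_le_of_le h1 h2) h3)
    h4) h5).trans (le_of_eq ?_)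
  ring

lemma norm_psi_le {q : ℍ[ℝ]} (hq : ‖q‖ = 1) {k : ℝ} (hk : 0 ≤ k) (J : M3) (w : V3) {v : V3}
    {ρv : ℝ} (hv : ‖v‖ ≤ ρv) :
    ‖psi k J q w v‖ ≤
      1 / 2 * k ^ 2 * ‖J‖ * ‖vec q‖ ^ 2 + 1 / 2 * k * ‖J‖ * ‖w‖ + 3 * k * ρv * ‖J‖ * ‖vec q‖ := by
  have h1 : ‖-(1 / 2 * k ^ 2) • (skew (vec q) * J) ⋆ᵥ vec q‖ ≤
      1 / 2 * k ^ 2 * (‖vec q‖ * (‖J‖ * ‖vec q‖)) := by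
    rw [norm_smul, norm_neg, Real.norm_of_nonneg (by positivity), act_mul]
    gcongr
    exact (norm_skew_act_le _ _).trans (by gcongr; exact norm_act_le _ _)
  have h2 : ‖(1 / 2 * k) • (G q * J) ⋆ᵥ w‖ ≤ 1 / 2 * k * (‖J‖ * ‖w‖) := by
    rw [norm_smul, Real.norm_of_nonneg (by positivity), act_mul]
    gcongr
    refine (norm_G_act_le _ _).trans ?_
    rw [hq, one_mul]; exact norm_act_le _ _
  have h3 : ‖k • Xi J 0 v ⋆ᵥ vec q‖ ≤ k * (3 * ‖J‖ * ρv * ‖vec q‖) := by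
    rw [norm_smul, Real.norm_of_nonneg hk]
    gcongr
    exact (norm_Xi_act_le _ _ _).trans (by gcongr)
  refine (norm_sub_le_of_le (norm_add_le_of_le h1 h2) h3).trans (le_of_eq ?_)
  ring

lemma norm_psi_sub_le {p q : ℍ[ℝ]} (hp : ‖p‖ = 1) {k : ℝ} (hk : 0 ≤ k)
    (J J' : M3) {w' w v' v : V3} {ρJ ρv r rw rv : ℝ} (hJ : ‖J' - J‖ ≤ ρJ) (hv' : ‖v'‖ ≤ ρv)
    (hv : ‖v‖ ≤ ρv) (hpq : ‖p - q‖ ≤ r) (hw : ‖w' - w‖ ≤ rw) (hdv : ‖v' - v‖ ≤ rv)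
    (hq : ‖q‖ = 1) :
    ‖psi k J' p w' v' - psi k J q w v‖ ≤
      1 / 2 * k ^ 2 * (r * (‖J'‖ * ‖vec q‖) + ‖vec q‖ * (‖J'‖ * r) + r * (‖J'‖ * r)
        + ‖vec q‖ * (ρJ * ‖vec q‖))
      + 1 / 2 * k * (r * (‖J'‖ * ‖w‖) + ‖J'‖ * rw + ρJ * ‖w‖)
      + k * (3 * ‖J'‖ * ρv * r + 3 * ‖J'‖ * rv * ‖vec q‖ + 3 * ρJ * ρv * ‖vec q‖) := by
  have hd : ‖vec p - vec q‖ ≤ r := by rw [← vec_sub]; exact (norm_vec_le _).trans hpq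
  have hr0 : 0 ≤ r := (norm_nonneg _).trans hpq
  have hJ0 : 0 ≤ ρJ := (norm_nonneg _).trans hJ
  have hv0 : 0 ≤ ρv := (norm_nonneg _).trans hv
  set x := vec q
  set y := vec p - vec q with hy
  have e : psi k J' p w' v' - psi k J q w v =
      -(1 / 2 * k ^ 2) • (skew y ⋆ᵥ (J' ⋆ᵥ x) + skew x ⋆ᵥ (J' ⋆ᵥ y) + skew y ⋆ᵥ (J' ⋆ᵥ y)
        + skew x ⋆ᵥ ((J' - J) ⋆ᵥ x))
      + (1 / 2 * k) • (G (p - q) ⋆ᵥ (J' ⋆ᵥ w) + G p ⋆ᵥ (J' ⋆ᵥ (w' - w)) + G q ⋆ᵥ ((J' - J) ⋆ᵥ w))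
      - k • (Xi J' 0 v' ⋆ᵥ y + Xi J' 0 (v' - v) ⋆ᵥ x + Xi (J' - J) 0 v ⋆ᵥ x) := by
    simp only [psi, hy, x, act_mul, skew_sub, G_sub, Xi_sub_left, Xi_sub_right, sub_act, act_sub,
      smul_add, smul_sub]
    abel
  have b (v : V3) (A : M3) (x : V3) : ‖skew v ⋆ᵥ (A ⋆ᵥ x)‖ ≤ ‖v‖ * (‖A‖ * ‖x‖) :=
    (norm_skew_act_le _ _).trans (by gcongr; exact norm_act_le _ _)
  have c (z : ℍ[ℝ]) (A : M3) (x : V3) : ‖G z ⋆ᵥ (A ⋆ᵥ x)‖ ≤ ‖z‖ * (‖A‖ * ‖x‖) :=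
    (norm_G_act_le _ _).trans (by gcongr; exact norm_act_le _ _)
  have h1 : _ ≤ r * (‖J'‖ * ‖x‖) := (b y J' x).trans (by gcongr)
  have h2 : _ ≤ ‖x‖ * (‖J'‖ * r) := (b x J' y).trans (by gcongr)
  have h3 : _ ≤ r * (‖J'‖ * r) := (b y J' y).trans (by gcongr)
  have h4 : _ ≤ ‖x‖ * (ρJ * ‖x‖) := (b x (J' - J) x).trans (by gcongr)
  have h5 : _ ≤ r * (‖J'‖ * ‖w‖) := (c (p - q) J' w).trans (by gcongr)
  have h6 : _ ≤ ‖J'‖ * rw := (c p J' (w' - w)).trans (by rw [hp, one_mul]; gcongr)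
  have h7 : _ ≤ ρJ * ‖w‖ := (c q (J' - J) w).trans (by rw [hq, one_mul]; gcongr)
  have h8 : _ ≤ 3 * ‖J'‖ * ρv * r := (norm_Xi_act_le J' v' y).trans (by gcongr)
  have h9 : _ ≤ 3 * ‖J'‖ * rv * ‖x‖ := (norm_Xi_act_le J' (v' - v) x).trans (by gcongr)
  have h10 : _ ≤ 3 * ρJ * ρv * ‖x‖ := (norm_Xi_act_le (J' - J) v x).trans (by gcongr)
  rw [e]
  refine norm_sub_le_of_le (norm_add_le_of_le ?_ ?_) ?_
  · rw [norm_smul, norm_neg, Real.norm_of_nonneg (by positivity)]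
    gcongr
    exact norm_add_le_of_le (norm_add_le_of_le (norm_add_le_of_le h1 h2) h3) h4
  · rw [norm_smul, Real.norm_of_nonneg (by positivity)]
    gcongr
    exact norm_add_le_of_le (norm_add_le_of_le h5 h6) h7
  · rw [norm_smul, Real.norm_of_nonneg hk]
    gcongr
    exact norm_add_le_of_le (norm_add_le_of_le h8 h9) h10

/-! ### The constants and their relaxation -/

namespace Params

/-- The sign conditions on the data under which all derived constants are nonnegative. -/
structure Signed (P : Params) : Prop where
  k_pos : 0 < P.k
  ε_pos : 0 < P.ε
  γ_nonneg : 0 ≤ P.γ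
  K_nonneg : 0 ≤ lamMax P.K
  ρq_nonneg : 0 ≤ P.ρq
  ρw_nonneg : 0 ≤ P.ρw
  ρE_nonneg : 0 ≤ P.ρE
  ρJ_nonneg : 0 ≤ P.ρJ
  ρd_nonneg : 0 ≤ P.ρd
  ρdhat_nonneg : 0 ≤ P.ρdhat
  ρv_nonneg : 0 ≤ P.ρv
  ρa_nonneg : 0 ≤ P.ρa

lemma ρ0_nonneg (P : Params) : 0 ≤ P.ρ0 := Real.sqrt_nonneg _

namespace Signed

variable {P : Params} (h : P.Signed)
include h

lemma ρs_nonneg : 0 ≤ P.ρs := by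
  have := h.ρw_nonneg; have := h.ρq_nonneg; have := h.ρv_nonneg; have := h.k_pos
  have := P.ρ0_nonneg
  unfold ρs; positivity

lemma a3_nonneg : 0 ≤ P.a3 := by
  have := h.ρJ_nonneg; have := h.k_pos; have := P.ρ0_nonneg
  unfold a3; positivity

lemma a2_nonneg : 0 ≤ P.a2 := by
  have := h.ρJ_nonneg; have := h.k_pos
  unfold a2; positivity

lemma a1_nonneg : 0 ≤ P.a1 := by
  have := h.a3_nonneg; have := h.ρJ_nonneg; have := h.k_pos; have := P.ρ0_nonneg
  have := h.ρq_nonneg; have := h.ρv_nonneg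
  unfold a1; positivity

lemma a0_nonneg : 0 ≤ P.a0 := by
  have := h.ρw_nonneg; have := h.ρJ_nonneg; have := h.k_pos; have := P.ρ0_nonneg
  have := h.ρq_nonneg; have := h.ρv_nonneg; have := h.ρa_nonneg; have := h.ρd_nonneg
  unfold a0; positivity

lemma b2_nonneg : 0 ≤ P.b2 := by
  have := h.k_pos
  unfold b2; positivity

lemma b1_nonneg : 0 ≤ P.b1 := by
  have := h.k_pos; have := h.b2_nonneg; have := h.a1_nonneg; have := P.ρ0_nonneg
  have := h.ρv_nonneg
  unfold b1; positivity

lemma b0_nonneg : 0 ≤ P.b0 := by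
  have := h.ρw_nonneg; have := h.k_pos; have := P.ρ0_nonneg; have := h.b2_nonneg
  have := h.ρq_nonneg; have := h.ρv_nonneg; have := h.ρa_nonneg; have := h.ρdhat_nonneg
  have := h.K_nonneg; have := h.ρs_nonneg; have := h.a1_nonneg; have := h.a0_nonneg
  have := h.γ_nonneg
  unfold b0; positivity

lemma φ2_nonneg {x : ℝ} (hx : 0 ≤ x) : 0 ≤ P.φ2 x 0 := by
  have := h.ρE_nonneg; have := P.ρ0_nonneg; have := h.a2_nonneg; have := h.b2_nonneg
  have := h.K_nonneg; have := h.ρs_nonneg; have := h.a1_nonneg; have := h.a0_nonneg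
  have := h.γ_nonneg; have := h.b1_nonneg; have := h.b0_nonneg; have := h.ε_pos
  unfold φ2; simp only [add_zero, mul_zero]; positivity

lemma φ1_mono {x y : ℝ} (hx : 0 ≤ x) (hxy : x ≤ y) : P.φ1 x 0 ≤ P.φ1 y 0 := by
  have := h.ρE_nonneg; have := h.a2_nonneg; have := h.b2_nonneg
  have := h.ρs_nonneg; have := h.a1_nonneg; have := h.b1_nonneg; have := h.ε_pos
  unfold φ1; simp only [add_zero, mul_zero]; gcongr

lemma φ2_mono {x y : ℝ} (hx : 0 ≤ x) (hxy : x ≤ y) : P.φ2 x 0 ≤ P.φ2 y 0 := by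
  have := h.ρE_nonneg; have := h.a2_nonneg; have := h.b2_nonneg
  have := h.ρs_nonneg; have := h.a1_nonneg; have := h.b1_nonneg; have := h.ε_pos
  unfold φ2; simp only [add_zero, mul_zero]; gcongr

lemma φbar_mono {x y : ℝ} (hx : 0 ≤ x) (hxy : x ≤ y) : P.φbar x 0 ≤ P.φbar y 0 :=
  max_le_max (h.φ1_mono hx hxy) (h.φ2_mono hx hxy)

end Signed

/-- The parameters with the ultimate bounds on the observer errors enlarged by `δ`: an ultimate
bound `ρ` on a signal is a bound `ρ + δ` from some time on. -/
def relax (P : Params) (δ : ℝ) : Params := { P with ρq := P.ρq + δ, ρw := P.ρw + δ }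

lemma relax_zero (P : Params) : P.relax 0 = P := by simp [relax]

lemma Valid.ε_pos {P : Params} (h : P.Valid) : 0 < P.ε := by
  have h1 := h.ρw_nonneg; have h2 := h.ρq_nonneg; have h3 := h.ρv_nonneg; have h4 := h.k_pos
  have h5 := P.ρ0_nonneg
  refine lt_of_le_of_lt ?_ h.ρs_lt_ε
  unfold ρs; positivity

lemma Valid.signed_relax {P : Params} (h : P.Valid) {δ : ℝ} (hδ : 0 ≤ δ) : (P.relax δ).Signed where
  k_pos := h.k_pos
  ε_pos := h.ε_pos
  γ_nonneg := h.γ_pos.le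
  K_nonneg := (lamMax_pos h.K_posDef).le
  ρq_nonneg := add_nonneg h.ρq_nonneg hδ
  ρw_nonneg := add_nonneg h.ρw_nonneg hδ
  ρE_nonneg := h.ρE_nonneg
  ρJ_nonneg := h.ρJ_nonneg
  ρd_nonneg := h.ρd_nonneg
  ρdhat_nonneg := h.ρdhat_nonneg
  ρv_nonneg := h.ρv_nonneg
  ρa_nonneg := h.ρa_nonneg

lemma Valid.signed {P : Params} (h : P.Valid) : P.Signed := by
  simpa [relax_zero] using h.signed_relax le_rfl

lemma Valid.κ_pos {P : Params} (h : P.Valid) : 0 < P.κ := by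
  have := h.gain
  unfold κ b3; linarith

lemma Valid.ρ0_le_relax {P : Params} (h : P.Valid) {δ : ℝ} (hδ : 0 ≤ δ) :
    P.ρ0 ≤ (P.relax δ).ρ0 := by
  have := h.ρq_nonneg
  unfold ρ0
  apply Real.sqrt_le_sqrt
  have : √(1 - (P.relax δ).ρq ^ 2) ≤ √(1 - P.ρq ^ 2) := by
    apply Real.sqrt_le_sqrt
    simp only [relax]
    nlinarith
  linarith

lemma Valid.a1_le_relax {P : Params} (h : P.Valid) {δ : ℝ} (hδ : 0 ≤ δ) :
    P.a1 ≤ (P.relax δ).a1 := by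
  have h1 := h.ρ0_le_relax hδ
  have := h.ρJ_nonneg; have := h.k_pos; have := P.ρ0_nonneg
  have := h.ρq_nonneg; have := h.ρv_nonneg
  have h2 : P.ρq ≤ (P.relax δ).ρq := by simp [relax, hδ]
  have e : (P.relax δ).a1 = P.k ^ 2 * (P.relax δ).ρ0 * ‖P.Jhat‖
    + P.k * ((1 / 2) * P.k * ((P.relax δ).ρ0 * ‖P.Jhat‖ + P.ρJ))
    + 3 * P.k * P.ρv * (P.ρJ + 2 * (P.relax δ).ρq * ‖P.Jhat‖) := rfl
  rw [e]; unfold a1 a3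
  gcongr

lemma Valid.a0_le_relax {P : Params} (h : P.Valid) {δ : ℝ} (hδ : 0 ≤ δ) :
    P.a0 ≤ (P.relax δ).a0 := by
  have h1 := h.ρ0_le_relax hδ
  have := h.ρJ_nonneg; have := h.k_pos; have := P.ρ0_nonneg
  have := h.ρq_nonneg; have := h.ρv_nonneg; have := h.ρw_nonneg; have := h.ρa_nonneg
  have h2 : P.ρq ≤ (P.relax δ).ρq := by simp [relax, hδ]
  have h3 : P.ρw ≤ (P.relax δ).ρw := by simp [relax, hδ]
  have e : (P.relax δ).a0 = (1 / 2) * P.k ^ 2 * (P.relax δ).ρ0 ^ 2 * ‖P.Jhat‖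
    + (1 / 2) * P.k * ((P.relax δ).ρw + 2 * (P.relax δ).ρq * P.ρv) * ‖P.Jhat‖
    + 3 * P.k * P.ρv * (P.relax δ).ρ0 * ‖P.Jhat‖ + 4 * (P.relax δ).ρq * P.ρv ^ 2 * ‖P.Jhat‖
    + 2 * (P.relax δ).ρq * P.ρa * ‖P.Jhat‖ + P.ρJ * P.ρv ^ 2 + P.ρJ * P.ρa + P.ρd := rfl
  rw [e]; unfold a0
  gcongr

/-- The mismatch between the switching gains, computed from the parameters, and the gains required
by the relaxed parameters. -/
noncomputable def slack (P : Params) (δ : ℝ) : ℝ :=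
  ((P.relax δ).a1 - P.a1) * (1 + P.γ) + ((P.relax δ).a0 - P.a0)

lemma continuous_ρ0 (P : Params) : Continuous fun δ => (P.relax δ).ρ0 := by
  unfold ρ0 relax; fun_prop

lemma continuous_ρs (P : Params) : Continuous fun δ => (P.relax δ).ρs := by
  have := P.continuous_ρ0
  unfold ρs; simp only [relax] at *; fun_prop

lemma continuous_a3 (P : Params) : Continuous fun δ => (P.relax δ).a3 := by
  have := P.continuous_ρ0
  unfold a3; simp only [relax] at *; fun_prop

lemma continuous_a1 (P : Params) : Continuous fun δ => (P.relax δ).a1 := by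
  have := P.continuous_ρ0; have := P.continuous_a3
  unfold a1; simp only [relax] at *; fun_prop

lemma continuous_a0 (P : Params) : Continuous fun δ => (P.relax δ).a0 := by
  have := P.continuous_ρ0
  unfold a0; simp only [relax] at *; fun_prop

lemma continuous_b1 (P : Params) : Continuous fun δ => (P.relax δ).b1 := by
  have := P.continuous_ρ0; have := P.continuous_a1
  unfold b1 b2; simp only [relax] at *; fun_prop

lemma continuous_b0 (P : Params) : Continuous fun δ => (P.relax δ).b0 := by
  have := P.continuous_ρ0; have := P.continuous_a1; have := P.continuous_a0
  have := P.continuous_ρs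
  unfold b0 b2; simp only [relax] at *; fun_prop

lemma continuous_κ (P : Params) : Continuous fun δ => (P.relax δ).κ := by
  have := P.continuous_a3
  unfold κ b3; simp only [relax] at *; fun_prop

lemma continuous_slack (P : Params) : Continuous P.slack := by
  have := P.continuous_a1; have := P.continuous_a0
  unfold slack; fun_prop

lemma continuous_φ2 (P : Params) (x : ℝ) : Continuous fun δ => (P.relax δ).φ2 (x + δ) 0 := by
  have := P.continuous_ρ0; have := P.continuous_a1; have := P.continuous_a0
  have := P.continuous_ρs; have := P.continuous_b1; have := P.continuous_b0
  unfold φ2 b2 a2; simp only [relax] at *; fun_prop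

lemma continuous_φbar (P : Params) (x : ℝ) : Continuous fun δ => (P.relax δ).φbar (x + δ) 0 := by
  have := P.continuous_ρ0; have := P.continuous_a1; have := P.continuous_a0
  have := P.continuous_ρs; have := P.continuous_b1; have := P.continuous_b0
  have := P.continuous_φ2 x
  unfold φbar φ1 b2 a2; simp only [relax] at *; fun_prop

end Params

/-! ### The torque balance at a fixed time -/

namespace Trajectory

variable {m : ℕ} {X : Trajectory m} {P : Params} {t δ : ℝ}

/-- The observer errors at time `t` are within the bounds of the parameters relaxed by `δ`. -/
structure Accurate (X : Trajectory m) (P : Params) (t δ : ℝ) : Prop where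
  t_nonneg : 0 ≤ t
  δ_nonneg : 0 ≤ δ
  qtil_le : ‖vec (X.qtil t)‖ ≤ P.ρq + δ
  qtil_re : 0 ≤ (X.qtil t).re
  wtil_le : ‖X.wtil t‖ ≤ P.ρw + δ

lemma qe_unit (hX : Assumptions P X) (hcl : IsClosedLoop P X) (ht : 0 ≤ t) : ‖X.qe t‖ = 1 :=
  norm_star_mul (hX.qd_unit t ht) (hcl.q_unit t ht)

lemma qehat_unit (hX : Assumptions P X) (ht : 0 ≤ t) : ‖X.qehat t‖ = 1 :=
  norm_star_mul (hX.qd_unit t ht) (hX.qhat_unit t ht)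

lemma star_qehat_mul_qe (hX : Assumptions P X) (ht : 0 ≤ t) :
    star (X.qehat t) * X.qe t = X.qtil t := by
  rw [qehat, qe, qtil, star_mul, star_star, mul_assoc, mul_star_mul (hX.qd_unit t ht)]

lemma norm_vec_qe_le (hX : Assumptions P X) (hcl : IsClosedLoop P X) (ht : 0 ≤ t) :
    ‖vec (X.qe t)‖ ≤ 1 := (norm_vec_le _).trans (qe_unit hX hcl ht).le

lemma Accurate.norm_qehat_sub_qe (h : X.Accurate P t δ) (hX : Assumptions P X)
    (hcl : IsClosedLoop P X) : ‖X.qehat t - X.qe t‖ ≤ (P.relax δ).ρ0 := by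
  refine norm_sub_le_of_vec (qehat_unit hX h.t_nonneg) (qe_unit hX hcl h.t_nonneg) ?_ ?_
  · rw [star_qehat_mul_qe hX h.t_nonneg]; exact h.qtil_re
  · rw [star_qehat_mul_qe hX h.t_nonneg]; exact h.qtil_le

lemma Accurate.norm_rotated_sub (h : X.Accurate P t δ) (hX : Assumptions P X)
    (hcl : IsClosedLoop P X) :
    ‖R (X.qehat t) ⋆ᵥ X.wd t - R (X.qe t) ⋆ᵥ X.wd t‖ ≤ 2 * (P.ρq + δ) * P.ρv := by
  have h1 := norm_R_sub_R_act_le (qehat_unit hX h.t_nonneg) (qe_unit hX hcl h.t_nonneg) (X.wd t)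
  rw [star_qehat_mul_qe hX h.t_nonneg] at h1
  have h2 := h.qtil_le
  have h3 := hX.wd_le t h.t_nonneg
  have h4 : 0 ≤ P.ρq + δ := (norm_nonneg _).trans h2
  exact h1.trans (by gcongr)

lemma Accurate.norm_wehat_sub_we (h : X.Accurate P t δ) (hX : Assumptions P X)
    (hcl : IsClosedLoop P X) :
    ‖X.wehat t - X.we t‖ ≤ P.ρw + δ + 2 * (P.ρq + δ) * P.ρv := by
  have e : X.wehat t - X.we t =
      X.wtil t - (R (X.qehat t) ⋆ᵥ X.wd t - R (X.qe t) ⋆ᵥ X.wd t) := by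
    rw [wehat, we, wtil]; abel
  rw [e]
  exact norm_sub_le_of_le h.wtil_le (h.norm_rotated_sub hX hcl)

lemma Accurate.norm_vec_qehat_sub (h : X.Accurate P t δ) (hX : Assumptions P X)
    (hcl : IsClosedLoop P X) : ‖vec (X.qehat t) - vec (X.qe t)‖ ≤ (P.relax δ).ρ0 := by
  rw [← vec_sub]; exact (norm_vec_le _).trans (h.norm_qehat_sub_qe hX hcl)

lemma Accurate.norm_shat_sub_s (h : X.Accurate P t δ) (hP : P.Valid) (hX : Assumptions P X)
    (hcl : IsClosedLoop P X) : ‖X.shat P t - X.s P t‖ ≤ (P.relax δ).ρs := by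
  have e : X.shat P t - X.s P t =
      (X.wehat t - X.we t) + P.k • (vec (X.qehat t) - vec (X.qe t)) := by
    rw [shat, s, smul_sub]; abel
  rw [e]
  refine norm_add_le_of_le (h.norm_wehat_sub_we hX hcl) ?_
  rw [norm_smul, Real.norm_of_nonneg hP.k_pos.le]
  have := hP.k_pos
  have := h.norm_vec_qehat_sub hX hcl
  change _ ≤ P.k * (P.relax δ).ρ0
  gcongr

lemma norm_we_le (hP : P.Valid) : ‖X.we t‖ ≤ ‖X.s P t‖ + P.k * ‖vec (X.qe t)‖ := by
  have e : X.we t = X.s P t - P.k • vec (X.qe t) := by rw [s]; abel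
  rw [e]
  refine (norm_sub_le _ _).trans ?_
  rw [norm_smul, Real.norm_of_nonneg hP.k_pos.le]

/-- The torque which the compensation in the control law leaves uncancelled. -/
noncomputable def residual (X : Trajectory m) (P : Params) (t : ℝ) : V3 :=
  (psid P.Jhat (X.qehat t) (X.wd t) (X.wd' t) - psid X.J (X.qe t) (X.wd t) (X.wd' t))
    - (psi P.k P.Jhat (X.qehat t) (X.wehat t) (R (X.qehat t) ⋆ᵥ X.wd t)
        - psi P.k X.J (X.qe t) (X.we t) (R (X.qe t) ⋆ᵥ X.wd t))
    - (X.τdhat t - X.τd t)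

lemma Accurate.norm_residual_le (h : X.Accurate P t δ) (hP : P.Valid) (hX : Assumptions P X)
    (hcl : IsClosedLoop P X) :
    ‖X.residual P t‖ ≤ (P.relax δ).a3 * ‖X.s P t‖ + (P.relax δ).a2 * ‖vec (X.qe t)‖ ^ 2
      + (P.relax δ).a1 * ‖vec (X.qe t)‖ + (P.relax δ).a0 := by
  have ht := h.t_nonneg
  have hk := hP.k_pos
  have hqh := qehat_unit hX ht
  have hq := qe_unit hX hcl ht
  have hv := hX.wd_le t ht
  have h1 := norm_psid_sub_le hqh hq X.J P.Jhat hX.Jtil_le hv (hX.wd'_le t ht)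
    (r := P.ρq + δ) (by rw [star_qehat_mul_qe hX ht]; exact h.qtil_le)
  have h2 := norm_psi_sub_le hqh hk.le X.J P.Jhat hX.Jtil_le (ρv := P.ρv)
    (by rwa [norm_R_act hqh]) (by rwa [norm_R_act hq]) (h.norm_qehat_sub_qe hX hcl)
    (h.norm_wehat_sub_we hX hcl) (h.norm_rotated_sub hX hcl) hq
  refine (norm_sub_le_of_le (norm_sub_le_of_le h1 h2) (hX.τdtil_le t ht)).trans ?_
  have hw := norm_we_le (X := X) (t := t) hP
  have hr := (P.relax δ).ρ0_nonneg
  set r := (P.relax δ).ρ0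
  set x := ‖vec (X.qe t)‖
  have hJ := hP.ρJ_nonneg
  have e3 : (P.relax δ).a3 = 1 / 2 * P.k * (r * ‖P.Jhat‖ + P.ρJ) := rfl
  have e2 : (P.relax δ).a2 = 1 / 2 * P.k ^ 2 * P.ρJ := rfl
  have e1 : (P.relax δ).a1 = P.k ^ 2 * r * ‖P.Jhat‖ + P.k * (P.relax δ).a3
    + 3 * P.k * P.ρv * (P.ρJ + 2 * (P.ρq + δ) * ‖P.Jhat‖) := rfl
  have e0 : (P.relax δ).a0 = (1 / 2) * P.k ^ 2 * r ^ 2 * ‖P.Jhat‖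
    + (1 / 2) * P.k * (P.ρw + δ + 2 * (P.ρq + δ) * P.ρv) * ‖P.Jhat‖
    + 3 * P.k * P.ρv * r * ‖P.Jhat‖ + 4 * (P.ρq + δ) * P.ρv ^ 2 * ‖P.Jhat‖
    + 2 * (P.ρq + δ) * P.ρa * ‖P.Jhat‖ + P.ρJ * P.ρv ^ 2 + P.ρJ * P.ρa + P.ρd := rfl
  have h3 : 1 / 2 * P.k * ((r * ‖P.Jhat‖ + P.ρJ) * ‖X.we t‖) ≤
      1 / 2 * P.k * ((r * ‖P.Jhat‖ + P.ρJ) * (‖X.s P t‖ + P.k * x)) := by gcongr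
  rw [e1, e0, e3, e2]
  linarith

/-- The amplitude `a₁ (‖q̂_e‖ + γ) + a₀` of the switching term. -/
noncomputable def amp (X : Trajectory m) (P : Params) (t : ℝ) : ℝ :=
  P.a1 * (‖vec (X.qehat t)‖ + P.γ) + P.a0

lemma amp_nonneg (hP : P.Valid) : 0 ≤ X.amp P t := by
  have := hP.signed.a1_nonneg; have := hP.signed.a0_nonneg; have := hP.γ_pos
  unfold amp; positivity

lemma norm_us_le (hP : P.Valid) : ‖X.us P t‖ ≤ X.amp P t := by
  have hε := hP.ε_pos
  have hg := amp_nonneg (X := X) (t := t) hP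
  rw [us]
  split_ifs with h
  · have hs : 0 < ‖X.shat P t‖ := hε.trans_le h
    change ‖-(X.amp P t / _) • _‖ ≤ _
    rw [norm_smul, norm_neg, Real.norm_of_nonneg (by positivity), div_mul_cancel₀ _ hs.ne']
  · change ‖-(X.amp P t / _) • _‖ ≤ _
    rw [norm_smul, norm_neg, Real.norm_of_nonneg (by positivity), div_mul_eq_mul_div,
      div_le_iff₀ hε]
    push Not at h
    gcongr

lemma Accurate.amp_le (h : X.Accurate P t δ) (hP : P.Valid) (hX : Assumptions P X)
    (hcl : IsClosedLoop P X) :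
    X.amp P t ≤ (P.relax δ).a1 * (P.γ + (P.relax δ).ρ0 + ‖vec (X.qe t)‖) + (P.relax δ).a0 := by
  have h1 := h.norm_vec_qehat_sub hX hcl
  have h2 := norm_sub_norm_le (vec (X.qehat t)) (vec (X.qe t))
  have h3 := hP.signed.a1_nonneg
  have h4 := hP.a1_le_relax h.δ_nonneg
  have h5 := hP.a0_le_relax h.δ_nonneg
  have h6 := hP.γ_pos
  have h7 : ‖vec (X.qehat t)‖ + P.γ ≤ P.γ + (P.relax δ).ρ0 + ‖vec (X.qe t)‖ := by linarith
  exact add_le_add (mul_le_mul h4 h7 (by positivity) (h3.trans h4)) h5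

lemma Accurate.norm_u_le (h : X.Accurate P t δ) (hP : P.Valid) (hX : Assumptions P X)
    (hcl : IsClosedLoop P X) :
    ‖X.u P t‖ ≤ (P.relax δ).b3 * ‖X.s P t‖ + (P.relax δ).b2 * ‖vec (X.qe t)‖ ^ 2
      + (P.relax δ).b1 * ‖vec (X.qe t)‖ + (P.relax δ).b0 := by
  have ht := h.t_nonneg
  have hk := hP.k_pos
  have hqh := qehat_unit hX ht
  have hv := hX.wd_le t ht
  have hρv := hP.ρv_nonneg
  have hK := lamMax_pos hP.K_posDef
  have hs : ‖X.shat P t‖ ≤ ‖X.s P t‖ + (P.relax δ).ρs :=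
    (norm_le_norm_add_norm_sub' _ _).trans (by gcongr; exact h.norm_shat_sub_s hP hX hcl)
  have h1 : ‖P.K ⋆ᵥ X.shat P t‖ ≤ lamMax P.K * (‖X.s P t‖ + (P.relax δ).ρs) :=
    (norm_act_le_lamMax hP.K_posDef _).trans (by gcongr)
  have h2 := (norm_us_le (X := X) (t := t) hP).trans (h.amp_le hP hX hcl)
  have h3 := norm_psid_le hqh P.Jhat hv (hX.wd'_le t ht)
  have h4 := norm_psi_le hqh hk.le P.Jhat (X.wehat t) (v := R (X.qehat t) ⋆ᵥ X.wd t) (ρv := P.ρv)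
    (by rwa [norm_R_act hqh])
  have h5 : ‖X.wehat t‖ ≤ ‖X.s P t‖ + P.k * ‖vec (X.qe t)‖
      + (P.ρw + δ + 2 * (P.ρq + δ) * P.ρv) :=
    (norm_le_norm_add_norm_sub' _ _).trans
      (add_le_add (norm_we_le hP) (h.norm_wehat_sub_we hX hcl))
  have h6 : ‖vec (X.qehat t)‖ ≤ ‖vec (X.qe t)‖ + (P.relax δ).ρ0 :=
    (norm_le_norm_add_norm_sub' _ _).trans (by gcongr; exact h.norm_vec_qehat_sub hX hcl)
  rw [u]
  rw [← norm_neg] at h1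
  refine (norm_sub_le_of_le (norm_sub_le_of_le (norm_add_le_of_le (norm_add_le_of_le h1 h2) h3) h4)
    (hX.τdhat_le t ht)).trans ?_
  set r := (P.relax δ).ρ0
  set x := ‖vec (X.qe t)‖
  set z := ‖X.s P t‖
  have h7 : 1 / 2 * P.k ^ 2 * ‖P.Jhat‖ * ‖vec (X.qehat t)‖ ^ 2
      + 1 / 2 * P.k * ‖P.Jhat‖ * ‖X.wehat t‖ + 3 * P.k * P.ρv * ‖P.Jhat‖ * ‖vec (X.qehat t)‖ ≤
      1 / 2 * P.k ^ 2 * ‖P.Jhat‖ * (x + r) ^ 2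
      + 1 / 2 * P.k * ‖P.Jhat‖ * (z + P.k * x + (P.ρw + δ + 2 * (P.ρq + δ) * P.ρv))
      + 3 * P.k * P.ρv * ‖P.Jhat‖ * (x + r) := by gcongr
  have e3 : (P.relax δ).b3 = 1 / 2 * P.k * ‖P.Jhat‖ + lamMax P.K := rfl
  have e2 : (P.relax δ).b2 = 1 / 2 * P.k ^ 2 * ‖P.Jhat‖ := rfl
  have e1 : (P.relax δ).b1 = 2 * (P.relax δ).b2 * r + 1 / 2 * P.k ^ 2 * ‖P.Jhat‖
    + 3 * P.k * P.ρv * ‖P.Jhat‖ + (P.relax δ).a1 := rfl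
  have e0 : (P.relax δ).b0 = (P.relax δ).b2 * r ^ 2
    + (1 / 2) * P.k * (P.ρw + δ + 2 * (P.ρq + δ) * P.ρv) * ‖P.Jhat‖
    + 3 * P.k * P.ρv * r * ‖P.Jhat‖ + lamMax P.K * (P.relax δ).ρs + (P.relax δ).a1 * (r + P.γ)
    + (P.relax δ).a0 + (P.ρv ^ 2 + P.ρa) * ‖P.Jhat‖ + P.ρdhat := rfl
  rw [e1, e0, e3, e2]
  linarith

/-- The right-hand side of `J ṡ`, up to terms orthogonal to `s`. -/
noncomputable def netTorque (X : Trajectory m) (P : Params) (t : ℝ) : V3 :=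
  psi P.k X.J (X.qe t) (X.we t) (R (X.qe t) ⋆ᵥ X.wd t)
    - psid X.J (X.qe t) (X.wd t) (X.wd' t) + X.τc P t + X.τd t

lemma netTorque_eq (hX : Assumptions P X) (ht : 0 ≤ t) :
    X.netTorque P t = -(P.K ⋆ᵥ X.shat P t) + X.us P t + X.residual P t + X.H t ⋆ᵥ X.u P t := by
  rw [netTorque, τc_eq X P t (fun i => (hX.ehat_mem t ht i).1) (hX.rank_Ehat t ht), residual]
  nth_rewrite 1 [u]
  abel

/-- The power `sᵀ J ṡ` with the contribution of the switching term left unestimated. -/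
lemma Accurate.inner_netTorque_le (h : X.Accurate P t δ) (hP : P.Valid) (hX : Assumptions P X)
    (hcl : IsClosedLoop P X) :
    inner ℝ (X.s P t) (X.netTorque P t) ≤ inner ℝ (X.s P t) (X.us P t)
      - (P.relax δ).κ * ‖X.s P t‖ ^ 2
      + ‖X.s P t‖ * (lamMax P.K * (P.relax δ).ρs
        + ((P.relax δ).a2 + P.ρE * (P.relax δ).b2) * ‖vec (X.qe t)‖ ^ 2
        + ((P.relax δ).a1 + P.ρE * (P.relax δ).b1) * ‖vec (X.qe t)‖
        + ((P.relax δ).a0 + P.ρE * (P.relax δ).b0)) := by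
  rw [netTorque_eq hX h.t_nonneg, inner_add_right, inner_add_right, inner_add_right]
  set s := X.s P t
  have hK := lamMax_pos hP.K_posDef
  have h1 : inner ℝ s (-(P.K ⋆ᵥ X.shat P t)) ≤
      -(lamMin P.K * ‖s‖ ^ 2) + ‖s‖ * (lamMax P.K * (P.relax δ).ρs) := by
    have e : -(P.K ⋆ᵥ X.shat P t) = -(P.K ⋆ᵥ s) - P.K ⋆ᵥ (X.shat P t - s) := by
      rw [act_sub]; abel
    have h2 := lamMin_mul_le (isSymm_of_posDef hP.K_posDef) s
    have h3 := abs_le.1 (abs_real_inner_le_norm s (P.K ⋆ᵥ (X.shat P t - s)))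
    have h4 : ‖P.K ⋆ᵥ (X.shat P t - s)‖ ≤ lamMax P.K * (P.relax δ).ρs :=
      (norm_act_le_lamMax hP.K_posDef _).trans (by gcongr; exact h.norm_shat_sub_s hP hX hcl)
    have h5 := mul_le_mul_of_nonneg_left h4 (norm_nonneg s)
    rw [e, inner_sub_right, inner_neg_right]
    linarith [h3.1]
  have h2 := (real_inner_le_norm s (X.residual P t)).trans
    (mul_le_mul_of_nonneg_left (h.norm_residual_le hP hX hcl) (norm_nonneg s))
  have h3 : inner ℝ s (X.H t ⋆ᵥ X.u P t) ≤ _ := (real_inner_le_norm s _).trans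
    (mul_le_mul_of_nonneg_left ((norm_act_le (X.H t) (X.u P t)).trans
      (mul_le_mul (hX.H_le t h.t_nonneg) (h.norm_u_le hP hX hcl) (norm_nonneg _) hP.ρE_nonneg))
      (norm_nonneg s))
  have e : (P.relax δ).κ = lamMin P.K - (P.relax δ).a3 - P.ρE * (P.relax δ).b3 := rfl
  rw [e]
  linarith

/-- Outside the boundary layer `u_s` has a constant multiple of the direction of `ŝ`, which deviates
from the direction of `s` by at most `2 ρ_s / ε`. -/
lemma Accurate.inner_us_le_of_le (h : X.Accurate P t δ) (hP : P.Valid) (hX : Assumptions P X)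
    (hcl : IsClosedLoop P X) (hs : P.ε ≤ ‖X.shat P t‖) :
    inner ℝ (X.s P t) (X.us P t) ≤
      X.amp P t * (‖X.s P t‖ * (2 * P.ε⁻¹ * (P.relax δ).ρs - 1)) := by
  have hε := hP.ε_pos
  set z := X.shat P t
  set s := X.s P t
  have hz : 0 < ‖z‖ := hε.trans_le hs
  have hd : ‖z - s‖ ≤ (P.relax δ).ρs := h.norm_shat_sub_s hP hX hcl
  have e : X.us P t = -(X.amp P t * ‖z‖⁻¹) • z := by rw [us, if_pos hs]; rfl
  rw [e, inner_smul_right, neg_mul, mul_assoc, ← mul_neg]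
  apply mul_le_mul_of_nonneg_left _ (amp_nonneg hP)
  -- replacing `z` by `s` costs `‖s‖ ‖z - s‖` once in the inner product and once in `‖z‖`
  have h1 : ‖s‖ * ‖z‖ - inner ℝ s z ≤ 2 * ‖s‖ * ‖z - s‖ := by
    have h2 : inner ℝ s z = ‖s‖ ^ 2 + inner ℝ s (z - s) := by
      rw [inner_sub_right, real_inner_self_eq_norm_sq]; ring
    have h3 := (abs_le.1 (abs_real_inner_le_norm s (z - s))).1
    have h4 : ‖z‖ ≤ ‖s‖ + ‖z - s‖ := norm_le_norm_add_norm_sub' _ _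
    nlinarith [norm_nonneg s]
  have h2 : ‖z‖⁻¹ ≤ P.ε⁻¹ := inv_anti₀ hε hs
  have h3 : ‖z‖⁻¹ * (2 * ‖s‖ * ‖z - s‖) ≤ P.ε⁻¹ * (2 * ‖s‖ * (P.relax δ).ρs) := by gcongr
  have h4 := mul_le_mul_of_nonneg_left h1 (inv_nonneg.2 hz.le)
  have h5 : ‖z‖⁻¹ * (‖s‖ * ‖z‖) = ‖s‖ := by field_simp
  rw [mul_sub, h5] at h4
  linarith

lemma Accurate.inner_us_le_of_lt (h : X.Accurate P t δ) (hP : P.Valid) (hX : Assumptions P X)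
    (hcl : IsClosedLoop P X) (hs : ‖X.shat P t‖ < P.ε) :
    inner ℝ (X.s P t) (X.us P t) ≤
      X.amp P t * (P.ε⁻¹ * (‖X.s P t‖ * (P.relax δ).ρs - ‖X.s P t‖ ^ 2)) := by
  have hε := hP.ε_pos
  have e : X.us P t = -(X.amp P t * P.ε⁻¹) • X.shat P t := by rw [us, if_neg hs.not_ge]; rfl
  rw [e, inner_smul_right, neg_mul, mul_assoc, ← mul_neg]
  apply mul_le_mul_of_nonneg_left _ (amp_nonneg hP)
  rw [← mul_neg]
  apply mul_le_mul_of_nonneg_left _ (inv_nonneg.2 hε.le)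
  set z := X.shat P t
  set s := X.s P t
  have hd : ‖z - s‖ ≤ (P.relax δ).ρs := h.norm_shat_sub_s hP hX hcl
  have h2 : inner ℝ s z = ‖s‖ ^ 2 + inner ℝ s (z - s) := by
    rw [inner_sub_right, real_inner_self_eq_norm_sq]; ring
  have h3 := (abs_le.1 (abs_real_inner_le_norm s (z - s))).1
  have h4 := mul_le_mul_of_nonneg_left hd (norm_nonneg s)
  linarith

/-- The dissipation estimate inside the boundary layer, where the switching term contributes
additional damping. -/
lemma Accurate.power_le_of_lt (h : X.Accurate P t δ) (hP : P.Valid) (hX : Assumptions P X)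
    (hcl : IsClosedLoop P X) {x : ℝ} (hx : ‖vec (X.qe t)‖ ≤ x) (hs : ‖X.shat P t‖ < P.ε) :
    inner ℝ (X.s P t) (X.netTorque P t) ≤
      -((P.relax δ).κ + P.ε⁻¹ * (P.a1 * P.γ + P.a0)) * ‖X.s P t‖ ^ 2
        + (P.relax δ).φ2 x 0 * ‖X.s P t‖ := by
  have hε := inv_nonneg.2 hP.ε_pos.le
  have h1 := h.inner_netTorque_le hP hX hcl
  have h2 := h.inner_us_le_of_lt hP hX hcl hs
  have h3 := (hP.signed_relax h.δ_nonneg).φ2_mono (norm_nonneg _) hx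
  have h4 := h.amp_le hP hX hcl
  have hρ := (hP.signed_relax h.δ_nonneg).ρs_nonneg
  have h5 : P.a1 * P.γ + P.a0 ≤ X.amp P t := by
    have := hP.signed.a1_nonneg
    unfold amp; nlinarith [mul_nonneg this (norm_nonneg (vec (X.qehat t)))]
  have hs0 := norm_nonneg (X.s P t)
  set s := ‖X.s P t‖
  set y := ‖vec (X.qe t)‖
  have h6 := mul_le_mul_of_nonneg_left h5 (mul_nonneg hε (sq_nonneg s))
  have h7 := mul_le_mul_of_nonneg_left h4 (mul_nonneg hε (mul_nonneg hs0 hρ))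
  have h8 := mul_le_mul_of_nonneg_right h3 hs0
  have e : (P.relax δ).φ2 y 0 = ((P.relax δ).a2 + P.ρE * (P.relax δ).b2) * y ^ 2
    + (P.ε⁻¹ * (P.relax δ).a1 * ((P.relax δ).ρs + 0) + (P.relax δ).a1 + P.ρE * (P.relax δ).b1) * y
    + P.ε⁻¹ * ((P.relax δ).ρs + 0) *
      ((P.relax δ).a1 * (P.γ + (P.relax δ).ρ0 + 0) + (P.relax δ).a0)
    + (P.relax δ).a0 + P.ρE * (P.relax δ).b0 + lamMax P.K * ((P.relax δ).ρs + 0) + 2 * 0 := rfl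
  rw [e] at h8
  linarith

/-- The dissipation estimate valid inside and outside the boundary layer. -/
lemma Accurate.power_le (h : X.Accurate P t δ) (hP : P.Valid) (hX : Assumptions P X)
    (hcl : IsClosedLoop P X) {x : ℝ} (hx : ‖vec (X.qe t)‖ ≤ x) :
    inner ℝ (X.s P t) (X.netTorque P t) ≤
      -(P.relax δ).κ * ‖X.s P t‖ ^ 2 + ((P.relax δ).φbar x 0 + P.slack δ) * ‖X.s P t‖ := by
  have ha1 := hP.a1_le_relax h.δ_nonneg
  have ha0 := hP.a0_le_relax h.δ_nonneg
  have ha1' := hP.signed.a1_nonneg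
  have ha0' := hP.signed.a0_nonneg
  have hγ := hP.γ_pos
  have hε := inv_nonneg.2 hP.ε_pos.le
  have hs0 := norm_nonneg (X.s P t)
  have hsl : 0 ≤ P.slack δ := by
    unfold Params.slack
    have := mul_nonneg (sub_nonneg.2 ha1) (by linarith : 0 ≤ 1 + P.γ)
    linarith
  rcases lt_or_ge ‖X.shat P t‖ P.ε with hs | hs
  · have h1 := h.power_le_of_lt hP hX hcl hx hs
    have h2 : (P.relax δ).φ2 x 0 ≤ (P.relax δ).φbar x 0 := le_max_right _ _
    have h3 := mul_le_mul_of_nonneg_right h2 hs0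
    have h4 : 0 ≤ P.ε⁻¹ * (P.a1 * P.γ + P.a0) * ‖X.s P t‖ ^ 2 := by positivity
    have h5 := mul_nonneg hsl hs0
    linarith
  · have h1 := h.inner_netTorque_le hP hX hcl
    have h2 := h.inner_us_le_of_le hP hX hcl hs
    have h3 : (P.relax δ).φ1 ‖vec (X.qe t)‖ 0 ≤ (P.relax δ).φbar x 0 :=
      ((hP.signed_relax h.δ_nonneg).φ1_mono (norm_nonneg _) hx).trans (le_max_left _ _)
    have h4 := h.amp_le hP hX hcl
    have hρ := (hP.signed_relax h.δ_nonneg).ρs_nonneg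
    have hr := (P.relax δ).ρ0_nonneg
    have hy := norm_vec_qe_le hX hcl h.t_nonneg
    have hy0 := norm_nonneg (vec (X.qe t))
    have h5 : P.a1 * (‖vec (X.qe t)‖ - (P.relax δ).ρ0 + P.γ) + P.a0 ≤ X.amp P t := by
      have h6 := h.norm_vec_qehat_sub hX hcl
      rw [norm_sub_rev] at h6
      have h7 := norm_sub_norm_le (vec (X.qe t)) (vec (X.qehat t))
      unfold amp
      gcongr
      linarith
    set s := ‖X.s P t‖
    set y := ‖vec (X.qe t)‖
    set r := (P.relax δ).ρ0
    set ρ := (P.relax δ).ρs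
    have h7 := mul_le_mul_of_nonneg_left h4 (mul_nonneg hε (mul_nonneg hs0 hρ))
    have h8 := mul_le_mul_of_nonneg_right h3 hs0
    have h9 : P.a1 * (y - r + P.γ) + P.a0 + P.slack δ ≥
        (P.relax δ).a1 * (y - r + P.γ) + (P.relax δ).a0 := by
      unfold Params.slack
      have : ((P.relax δ).a1 - P.a1) * (y - r + P.γ) ≤ ((P.relax δ).a1 - P.a1) * (1 + P.γ) :=
        mul_le_mul_of_nonneg_left (by linarith) (sub_nonneg.2 ha1)
      linarith
    have h10 := mul_le_mul_of_nonneg_left (h9.le.trans (add_le_add_left h5 _)) hs0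
    have e : (P.relax δ).φ1 y 0 = ((P.relax δ).a2 + P.ρE * (P.relax δ).b2) * y ^ 2
      + (2 * P.ε⁻¹ * (P.relax δ).a1 * (ρ + 0) + P.ρE * (P.relax δ).b1) * y
      + 2 * P.ε⁻¹ * (ρ + 0) * ((P.relax δ).a1 * (P.γ + r + 0) + (P.relax δ).a0)
      + P.ρE * (P.relax δ).b0 + (2 + lamMax P.K + (P.relax δ).a1) * 0
      - ((P.relax δ).a1 * P.γ - (P.relax δ).a1 * r - lamMax P.K * ρ) := rfl
    rw [e] at h8
    linarith

end Trajectory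

/-! ### Ultimate bounds from differential inequalities -/

lemma limsupLe_of_forall {f : ℝ → ℝ} {c : ℝ} (h0 : ∀ t, 0 ≤ f t)
    (h : ∀ δ > 0, ∀ᶠ t in atTop, f t ≤ c + δ) : LimsupLe f c := by
  have hc : IsCoboundedUnder (· ≤ ·) atTop f :=
    (isBoundedUnder_of_eventually_ge (Eventually.of_forall h0)).isCoboundedUnder_le
  exact ⟨⟨c + 1, by simpa using h 1 one_pos⟩,
    le_of_forall_pos_le_add fun δ hδ => limsup_le_of_le hc (h δ hδ)⟩

lemma LimsupLe.eventually_le {f : ℝ → ℝ} {c c' : ℝ} (h : LimsupLe f c) (hc : c < c') :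
    ∀ᶠ t in atTop, f t ≤ c' :=
  (eventually_lt_of_limsup_lt (h.2.trans_lt hc) h.1).mono fun _ => le_of_lt

lemma LimsupLe.mono {f : ℝ → ℝ} {c c' : ℝ} (h : LimsupLe f c) (hc : c ≤ c') : LimsupLe f c' :=
  ⟨h.1, h.2.trans hc⟩

/-- A continuous function that decreases at a definite rate while it is above the level `c`
eventually stays below `c`. -/
lemma eventually_le_of_decrease {f : ℝ → ℝ} {T c η : ℝ} (hf : ContinuousOn f (Set.Ici T))
    (hη : 0 < η) (h : ∀ a b, T ≤ a → a ≤ b → (∀ t ∈ Set.Ioo a b, c < f t) →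
      f b - f a ≤ -η * (b - a)) : ∀ᶠ t in atTop, f t ≤ c := by
  obtain ⟨t₁, ht₁, hft₁⟩ : ∃ t₁, T ≤ t₁ ∧ f t₁ ≤ c := by
    by_contra! hcon
    have h0 := hcon T le_rfl
    have hb : T ≤ T + (f T - c) / η := by
      have : 0 ≤ (f T - c) / η := div_nonneg (by linarith) hη.le
      linarith
    have h1 := h T (T + (f T - c) / η) le_rfl hb fun t ht => hcon t ht.1.le
    have h2 := hcon _ hb
    have h3 : -η * (T + (f T - c) / η - T) = c - f T := by field_simp; ring
    linarith
  filter_upwards [eventually_ge_atTop t₁] with t₂ ht₂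
  by_contra! hcon
  -- on the last excursion above `c` before `t₂` the function would have to increase
  set S := Set.Icc t₁ t₂ ∩ f ⁻¹' Set.Iic c
  have hS : IsCompact S := isCompact_Icc.of_isClosed_subset
    ((hf.mono fun t ht => ht₁.trans ht.1).preimage_isClosed_of_isClosed isClosed_Icc isClosed_Iic)
    Set.inter_subset_left
  have hmem : sSup S ∈ S := hS.sSup_mem ⟨t₁, ⟨le_rfl, ht₂⟩, hft₁⟩
  have h1 := h (sSup S) t₂ (ht₁.trans hmem.1.1) hmem.1.2 fun t ht => by
    by_contra! hle
    exact absurd (le_csSup hS.bddAbove ⟨⟨hmem.1.1.trans ht.1.le, ht.2.le⟩, hle⟩) ht.1.not_ge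
  have h2 : f (sSup S) ≤ c := hmem.2
  nlinarith [hmem.1.2]

lemma mul_sub_le_of_le_deriv {g g' : ℝ → ℝ} {T δ a b : ℝ} (hTa : T ≤ a) (hab : a ≤ b)
    (hg : ∀ t, T ≤ t → HasDerivWithinAt g (g' t) (Set.Ici T) t)
    (h : ∀ t ∈ Set.Ioo a b, δ ≤ g' t) : δ * (b - a) ≤ g b - g a := by
  have hd : ∀ t ∈ Set.Ioo a b, HasDerivAt g (g' t) t := fun t ht =>
    (hg t (hTa.trans ht.1.le)).hasDerivAt (Ici_mem_nhds (hTa.trans_lt ht.1))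
  refine (convex_Icc a b).mul_sub_le_image_sub_of_le_deriv (fun t ht => ?_) ?_ ?_ a ⟨le_rfl, hab⟩
    b ⟨hab, le_rfl⟩ hab
  · exact (hg t (hTa.trans ht.1)).continuousWithinAt.mono fun x hx => hTa.trans hx.1
  · rw [interior_Icc]
    exact fun t ht => (hd t ht).differentiableAt.differentiableWithinAt
  · rw [interior_Icc]
    intro t ht
    rw [(hd t ht).deriv]; exact h t ht

/-- A function that increases at a definite rate while its absolute value is below `r` leaves
`(-r, r)` for good. It may end up on either side: starting below `-r` it need not move. -/
lemma eventually_le_abs {g g' : ℝ → ℝ} {T r δ : ℝ} (hr : 0 < r) (hδ : 0 < δ)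
    (hg : ∀ t, T ≤ t → HasDerivWithinAt g (g' t) (Set.Ici T) t)
    (h : ∀ t, T ≤ t → |g t| < r → δ ≤ g' t) : ∀ᶠ t in atTop, r ≤ |g t| := by
  have hc : ContinuousOn g (Set.Ici T) := fun t ht => (hg t ht).continuousWithinAt
  by_cases hA : ∃ t₁, T ≤ t₁ ∧ -r < g t₁
  · obtain ⟨t₁, ht₁, hgt₁⟩ := hA
    -- `g` cannot come back to `-r`, because it increases just above this level
    have hstay : ∀ t, t₁ ≤ t → -r < g t := by
      by_contra! hcon
      obtain ⟨t₂, ht₂, hgt₂⟩ := hcon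
      set S := Set.Icc t₁ t₂ ∩ g ⁻¹' Set.Iic (-r)
      have hS : IsCompact S := isCompact_Icc.of_isClosed_subset
        ((hc.mono fun t ht => ht₁.trans ht.1).preimage_isClosed_of_isClosed isClosed_Icc
          isClosed_Iic) Set.inter_subset_left
      have hmem : sInf S ∈ S := hS.sInf_mem ⟨t₂, ⟨ht₂, le_rfl⟩, hgt₂⟩
      set z := sInf S
      have hgz : g z ≤ -r := hmem.2
      have hlt : t₁ < z := lt_of_le_of_ne hmem.1.1 fun he => by rw [← he] at hgz; linarith
      have hbefore : ∀ t, t₁ ≤ t → t < z → -r < g t := fun t h1 h2 => by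
        by_contra! hle
        exact absurd (csInf_le hS.bddBelow ⟨⟨h1, h2.le.trans hmem.1.2⟩, hle⟩) h2.not_ge
      have hev : ∀ᶠ t in 𝓝[<] z, g t < r := by
        have h1 : ContinuousAt g z :=
          (hc z (ht₁.trans hlt.le)).continuousAt (Ici_mem_nhds (ht₁.trans_lt hlt))
        exact nhdsWithin_le_nhds (h1.eventually (gt_mem_nhds (by linarith)))
      obtain ⟨l, hl, hlz⟩ := (mem_nhdsLT_iff_exists_Ioo_subset' hlt).1 hev
      obtain ⟨a, ha1, ha2⟩ := exists_between (max_lt hl hlt)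
      have hal : l < a := (le_max_left _ _).trans_lt ha1
      have hat : t₁ < a := (le_max_right _ _).trans_lt ha1
      have h1 := mul_sub_le_of_le_deriv (ht₁.trans hat.le) ha2.le hg fun t ht =>
        h t (ht₁.trans (hat.le.trans ht.1.le)) (abs_lt.2 ⟨hbefore t (hat.le.trans ht.1.le) ht.2,
          hlz ⟨hal.trans ht.1, ht.2⟩⟩)
      have h2 := hbefore a hat.le ha2
      have h3 := mul_nonneg hδ.le (sub_nonneg.2 ha2.le)
      linarith
    have hev : ∀ᶠ t in atTop, -g t ≤ -r := by
      refine eventually_le_of_decrease (T := t₁)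
        (hc.mono (Set.Ici_subset_Ici.2 ht₁)).neg hδ fun a b ha hab hlt => ?_
      have h1 := mul_sub_le_of_le_deriv (ht₁.trans ha) hab hg fun t ht =>
        h t (ht₁.trans (ha.trans ht.1.le)) (abs_lt.2 ⟨hstay t (ha.trans ht.1.le), by
          have := hlt t ht; linarith⟩)
      linarith
    filter_upwards [hev] with t ht
    exact le_trans (by linarith) (le_abs_self _)
  · push Not at hA
    filter_upwards [eventually_ge_atTop T] with t ht
    have := hA t ht
    exact le_trans (by linarith) (neg_le_abs _)

lemma sub_le_of_absolutelyContinuous {f : ℝ → ℝ} {a b M : ℝ} (hab : a ≤ b)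
    (hf : AbsolutelyContinuousOnInterval f a b)
    (h : ∀ᵐ t ∂volume, t ∈ Set.Ioo a b → deriv f t ≤ M) : f b - f a ≤ M * (b - a) := by
  rw [← hf.integral_deriv_eq_sub]
  have h1 : ∫ _ in a..b, M = M * (b - a) := by simp [mul_comm]
  rw [← h1]
  refine intervalIntegral.integral_mono_ae_restrict hab hf.intervalIntegrable_deriv (by simp) ?_
  rw [← restrict_Ioo_eq_restrict_Icc]
  exact (ae_restrict_iff' measurableSet_Ioo).2 h

lemma absolutelyContinuous_of_dist_le {E F : Type*} [PseudoMetricSpace E] [PseudoMetricSpace F]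
    {f : ℝ → E} {g : ℝ → F} {a b : ℝ} (hf : AbsolutelyContinuousOnInterval f a b)
    (h : ∀ x y, dist (g x) (g y) ≤ dist (f x) (f y)) : AbsolutelyContinuousOnInterval g a b := by
  rw [absolutelyContinuousOnInterval_iff] at hf ⊢
  intro ε hε
  obtain ⟨δ, hδ, hd⟩ := hf ε hε
  exact ⟨δ, hδ, fun I hI hlt => (Finset.sum_le_sum fun i _ => h _ _).trans_lt (hd I hI hlt)⟩

lemma absolutelyContinuous_of_deriv_bound {E : Type*} [NormedAddCommGroup E] [NormedSpace ℝ E]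
    {f f' : ℝ → E} {T C : ℝ} (hT : 0 ≤ T)
    (hf : ∀ t, 0 ≤ t → HasDerivWithinAt f (f' t) (Set.Ici 0) t)
    (hC : ∀ t ∈ Set.Icc 0 T, ‖f' t‖ ≤ C) : AbsolutelyContinuousOnInterval f 0 T := by
  have h : LipschitzOnWith C.toNNReal f (Set.uIcc 0 T) := by
    rw [Set.uIcc_of_le hT]
    refine (convex_Icc 0 T).lipschitzOnWith_of_nnnorm_hasDerivWithin_le
      (fun t ht => (hf t ht.1).mono fun x hx => hx.1) fun t ht => ?_
    rw [← NNReal.coe_le_coe, coe_nnnorm]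
    exact (hC t ht).trans (Real.le_coe_toNNReal C)
  exact h.absolutelyContinuousOnInterval

/-! ### Error dynamics -/

/-- The vector part as a continuous linear map. -/
noncomputable def vecL : ℍ[ℝ] →L[ℝ] V3 :=
  LinearMap.toContinuousLinearMap
    { toFun := vec
      map_add' := fun p q => V3.ext (by simp) (by simp) (by simp)
      map_smul' := fun c q => V3.ext (by simp) (by simp) (by simp) }

/-- The embedding of vectors as pure quaternions, as a continuous linear map. -/
noncomputable def pureL : V3 →L[ℝ] ℍ[ℝ] :=
  LinearMap.toContinuousLinearMap
    { toFun := quat 0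
      map_add' := fun p q => by ext <;> simp
      map_smul' := fun c q => by ext <;> simp }

/-- The scalar part as a continuous linear map. -/
noncomputable def reL : ℍ[ℝ] →L[ℝ] ℝ :=
  LinearMap.toContinuousLinearMap
    { toFun := fun q => q.re
      map_add' := fun p q => by simp
      map_smul' := fun c q => by simp }

lemma vecL_apply (q : ℍ[ℝ]) : vecL q = vec q := rfl
lemma pureL_apply (v : V3) : pureL v = quat 0 v := rfl

lemma star_quat_zero (v : V3) : star (quat 0 v) = -quat 0 v := by
  ext <;> simp

lemma quat_zero_sub (v w : V3) : quat 0 (v - w) = quat 0 v - quat 0 w := map_sub pureL v w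

lemma vec_kin (q : ℍ[ℝ]) (w : V3) : vec (kin q w) = (1 / 2 : ℝ) • (G q ⋆ᵥ w) := vec_quat _ _

lemma vec_commutator (v w : V3) :
    vec ((1 / 2 : ℝ) • (quat 0 v * quat 0 w - quat 0 w * quat 0 v)) = -(skew w ⋆ᵥ v) := by
  apply V3.ext <;> simp [act_apply, skew] <;> ring

lemma star_smul_quat (c : ℝ) (q : ℍ[ℝ]) : star (c • q) = c • star q := Quaternion.star_smul c q

lemma hasDerivWithinAt_star {f : ℝ → ℍ[ℝ]} {f' : ℍ[ℝ]} {S : Set ℝ} {t : ℝ}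
    (h : HasDerivWithinAt f f' S t) : HasDerivWithinAt (fun t => star (f t)) (star f') S t :=
  haveI : StarModule ℝ ℍ[ℝ] := ⟨fun r q => star_smul_quat r q⟩
  h.star

namespace Trajectory

variable {m : ℕ} {X : Trajectory m} {P : Params} {t : ℝ}

/-- The attitude error obeys the attitude kinematics with the rate error. -/
lemma hasDerivWithinAt_qe (hX : Assumptions P X) (hcl : IsClosedLoop P X) (ht : 0 ≤ t) :
    HasDerivWithinAt X.qe (kin (X.qe t) (X.we t)) (Set.Ici 0) t := by
  have h := (hasDerivWithinAt_star (hX.qd_kin t ht)).mul (hcl.q_kin t ht)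
  refine h.congr_deriv ?_
  have hu := qe_unit hX hcl ht
  rw [kin_eq, kin_eq, kin_eq, we, quat_zero_sub, quat_R_act hu]
  rw [mul_sub, mul_assoc (star (X.qe t)), ← mul_assoc (X.qe t), self_mul_star_of_norm hu, one_mul]
  simp only [qe, star_smul_quat, star_mul, star_quat_zero]
  simp only [smul_sub, mul_assoc, neg_mul, smul_mul_assoc, mul_smul_comm, smul_neg]
  abel

/-- The desired rate in the body frame, `R(q_e) ω_d`. -/
noncomputable def vd (X : Trajectory m) (t : ℝ) : V3 := R (X.qe t) ⋆ᵥ X.wd t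

lemma norm_vd_le (hX : Assumptions P X) (hcl : IsClosedLoop P X) (ht : 0 ≤ t) :
    ‖X.vd t‖ ≤ P.ρv := by
  rw [vd, norm_R_act (qe_unit hX hcl ht)]; exact hX.wd_le t ht

lemma hasDerivWithinAt_vd (hX : Assumptions P X) (hcl : IsClosedLoop P X) (ht : 0 ≤ t) :
    HasDerivWithinAt X.vd (-(skew (X.we t) ⋆ᵥ X.vd t) + R (X.qe t) ⋆ᵥ X.wd' t) (Set.Ici 0) t := by
  have hq := hasDerivWithinAt_qe hX hcl ht
  have hw := pureL.hasFDerivAt.comp_hasDerivWithinAt t (hX.wd_deriv t ht)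
  have h := vecL.hasFDerivAt.comp_hasDerivWithinAt t (((hasDerivWithinAt_star hq).mul hw).mul hq)
  have hu := qe_unit hX hcl ht
  have h2 : HasDerivWithinAt X.vd _ (Set.Ici 0) t :=
    h.congr (fun x hx => R_act_eq (qe_unit hX hcl hx) _) (R_act_eq hu _)
  refine h2.congr_deriv ?_
  rw [← vec_commutator, vd, quat_R_act hu, R_act_eq hu]
  rw [vecL_apply, ← vecL_apply, ← vecL_apply, ← vecL_apply, ← map_add]
  congr 1
  rw [kin_eq]
  simp only [Function.comp_apply, pureL_apply, Pi.mul_apply]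
  simp only [star_smul_quat, star_mul, star_quat_zero]
  simp only [smul_sub, mul_assoc, neg_mul, smul_mul_assoc, mul_smul_comm, smul_neg, add_mul]
  abel

/-- Only the summand `ω` of the sliding variable may fail to be differentiable everywhere. -/
lemma s_eq (X : Trajectory m) (P : Params) (t : ℝ) :
    X.s P t = X.w t + (P.k • vec (X.qe t) - X.vd t) := by
  rw [s, we, vd]; abel

lemma hasDerivWithinAt_s_sub_w (hX : Assumptions P X) (hcl : IsClosedLoop P X) (ht : 0 ≤ t) :
    HasDerivWithinAt (fun t => P.k • vec (X.qe t) - X.vd t)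
      ((P.k / 2) • (G (X.qe t) ⋆ᵥ X.we t)
        - (-(skew (X.we t) ⋆ᵥ X.vd t) + R (X.qe t) ⋆ᵥ X.wd' t)) (Set.Ici 0) t := by
  have h := vecL.hasFDerivAt.comp_hasDerivWithinAt t (hasDerivWithinAt_qe hX hcl ht)
  refine ((h.const_smul P.k).sub (hasDerivWithinAt_vd hX hcl ht)).congr_deriv ?_
  rw [vecL_apply, vec_kin, smul_smul]
  congr 3; ring

lemma absolutelyContinuous_s (hP : P.Valid) (hX : Assumptions P X) (hcl : IsClosedLoop P X)
    {T : ℝ} (hT : 0 < T) : AbsolutelyContinuousOnInterval (X.s P) 0 T := by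
  have e : X.s P = fun t => X.w t + (P.k • vec (X.qe t) - X.vd t) := funext (X.s_eq P)
  obtain ⟨C, hC⟩ := (hcl.w_ac T hT).exists_bound
  have hk := hP.k_pos
  rw [e]
  refine (hcl.w_ac T hT).fun_add (absolutelyContinuous_of_deriv_bound hT.le
    (C := P.k / 2 * (C + P.ρv) + ((C + P.ρv) * P.ρv + P.ρa))
    (fun t ht => hasDerivWithinAt_s_sub_w hX hcl ht) fun t ht => ?_)
  have hu := qe_unit hX hcl ht.1
  have hv := norm_vd_le hX hcl ht.1
  have hwe : ‖X.we t‖ ≤ C + P.ρv :=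
    norm_sub_le_of_le (hC t (by rwa [Set.uIcc_of_le hT.le])) hv
  refine norm_sub_le_of_le ?_ (norm_add_le_of_le ?_ ?_)
  · rw [norm_smul, Real.norm_of_nonneg (by positivity)]
    gcongr
    refine (norm_G_act_le _ _).trans ?_
    rwa [hu, one_mul]
  · rw [norm_neg]
    refine (norm_skew_act_le _ _).trans ?_
    gcongr
    exact (norm_nonneg _).trans hwe
  · rw [norm_R_act hu]; exact hX.wd'_le t ht.1

lemma continuousOn_s (hP : P.Valid) (hX : Assumptions P X) (hcl : IsClosedLoop P X) :
    ContinuousOn (X.s P) (Set.Ici 0) := by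
  intro t ht
  have h0 : (0 : ℝ) < t + 1 := by linarith [Set.mem_Ici.1 ht]
  have h := (absolutelyContinuous_s hP hX hcl h0).continuousOn
  rw [Set.uIcc_of_le h0.le] at h
  refine (h t ⟨ht, by linarith⟩).mono_of_mem_nhdsWithin ?_
  have := Iic_mem_nhds (show t < t + 1 by linarith)
  filter_upwards [mem_nhdsWithin_of_mem_nhds this, self_mem_nhdsWithin] with x hx hx0
  exact ⟨hx0, hx⟩

/-- Twice the kinetic energy of the sliding variable, the Lyapunov function of the loop. -/
noncomputable def energy (X : Trajectory m) (P : Params) (t : ℝ) : ℝ :=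
  inner ℝ (X.s P t) (X.J ⋆ᵥ X.s P t)

lemma absolutelyContinuous_energy (hP : P.Valid) (hX : Assumptions P X) (hcl : IsClosedLoop P X)
    {T : ℝ} (hT : 0 < T) : AbsolutelyContinuousOnInterval (X.energy P) 0 T := by
  have h (i : Fin 3) : AbsolutelyContinuousOnInterval (fun t => X.s P t i) 0 T :=
    absolutelyContinuous_of_dist_le (absolutelyContinuous_s hP hX hcl hT) fun x y => by
      rw [dist_eq_norm, dist_eq_norm]
      exact PiLp.norm_apply_le (X.s P x - X.s P y) i
  have e : X.energy P = fun t =>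
      X.s P t 0 * (X.J 0 0 * X.s P t 0 + X.J 0 1 * X.s P t 1 + X.J 0 2 * X.s P t 2)
      + X.s P t 1 * (X.J 1 0 * X.s P t 0 + X.J 1 1 * X.s P t 1 + X.J 1 2 * X.s P t 2)
      + X.s P t 2 * (X.J 2 0 * X.s P t 0 + X.J 2 1 * X.s P t 1 + X.J 2 2 * X.s P t 2) := by
    funext t
    rw [energy, inner_eq, act_apply, act_apply, act_apply]
  have hrow (i : Fin 3) : AbsolutelyContinuousOnInterval
      (fun t => X.J i 0 * X.s P t 0 + X.J i 1 * X.s P t 1 + X.J i 2 * X.s P t 2) 0 T :=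
    (((h 0).const_mul _).fun_add ((h 1).const_mul _)).fun_add ((h 2).const_mul _)
  rw [e]
  exact (((h 0).fun_mul (hrow 0)).fun_add ((h 1).fun_mul (hrow 1))).fun_add
    ((h 2).fun_mul (hrow 2))

/-- Power balance: only the net torque does work on the sliding variable. -/
lemma deriv_energy (hX : Assumptions P X) (hcl : IsClosedLoop P X) :
    ∀ᵐ t ∂volume, 0 < t → deriv (X.energy P) t = 2 * inner ℝ (X.s P t) (X.netTorque P t) := by
  filter_upwards [hcl.w_dyn] with t h ht
  obtain ⟨w', hw', hdyn⟩ := h ht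
  have hs : HasDerivAt (X.s P) _ t := (hw'.add ((hasDerivWithinAt_s_sub_w hX hcl ht.le).hasDerivAt
    (Ici_mem_nhds ht))).congr_of_eventuallyEq (Eventually.of_forall (X.s_eq P))
  set s' := w' + ((P.k / 2) • (G (X.qe t) ⋆ᵥ X.we t)
    - (-(skew (X.we t) ⋆ᵥ X.vd t) + R (X.qe t) ⋆ᵥ X.wd' t)) with hs'
  have hJs : HasDerivAt (fun t => X.J ⋆ᵥ X.s P t) (X.J ⋆ᵥ s') t :=
    (LinearMap.toContinuousLinearMap (Matrix.toEuclideanLin X.J)).hasFDerivAt.comp_hasDerivAt t hs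
  have hE : HasDerivAt (X.energy P)
      (inner ℝ (X.s P t) (X.J ⋆ᵥ s') + inner ℝ s' (X.J ⋆ᵥ X.s P t)) t := hs.inner ℝ hJs
  have e4 : inner ℝ s' (X.J ⋆ᵥ X.s P t) = inner ℝ (X.s P t) (X.J ⋆ᵥ s') := by
    rw [inner_act_symm hX.J_symm, real_inner_comm]
  have hw : X.w t = X.we t + X.vd t := by rw [we, vd]; abel
  have e1 : X.J ⋆ᵥ s' = (-(skew (X.we t + X.vd t) ⋆ᵥ (X.J ⋆ᵥ (X.we t + X.vd t)))
      + X.J ⋆ᵥ (skew (X.we t) ⋆ᵥ X.vd t) - X.J ⋆ᵥ (R (X.qe t) ⋆ᵥ X.wd' t)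
      + (P.k / 2) • X.J ⋆ᵥ (G (X.qe t) ⋆ᵥ X.we t)) + (X.τc P t + X.τd t) := by
    have e2 : X.J ⋆ᵥ s' = X.J ⋆ᵥ w' + ((P.k / 2) • X.J ⋆ᵥ (G (X.qe t) ⋆ᵥ X.we t)
        - (-(X.J ⋆ᵥ (skew (X.we t) ⋆ᵥ X.vd t)) + X.J ⋆ᵥ (R (X.qe t) ⋆ᵥ X.wd' t))) := by
      simp only [hs', act, map_add, map_sub, map_neg, map_smul]
    rw [e2, hdyn, hw]; abel
  have e3 : inner ℝ (X.s P t) (X.J ⋆ᵥ s') = inner ℝ (X.s P t) (X.netTorque P t) := by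
    have h1 := inner_closed_loop hX.J_symm P.k (X.qe t) (X.we t) (X.vd t) (R (X.qe t) ⋆ᵥ X.wd' t)
    rw [e1, inner_add_right]
    change inner ℝ (X.s P t) _ = inner ℝ (X.s P t) _ at h1
    rw [h1, ← inner_add_right]
    congr 1
    rw [netTorque, psid, act_mul _ (R (X.qe t)), vd]; abel
  rw [hE.deriv, e4, e3]; ring

end Trajectory

/-! ### Ultimate bounds for the closed loop -/

namespace Trajectory

variable {m : ℕ} {X : Trajectory m} {P : Params} {t : ℝ}

/-- A dissipation estimate `sᵀ J ṡ ≤ -κ ‖s‖² + Φ ‖s‖`, valid in the limit, bounds `s` ultimately. -/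
lemma limsupLe_s (hP : P.Valid) (hX : Assumptions P X) (hcl : IsClosedLoop P X) {κ Φ : ℝ}
    (hκ : 0 < κ) (hΦ : 0 ≤ Φ)
    (h : ∀ η > 0, ∀ᶠ t in atTop, inner ℝ (X.s P t) (X.netTorque P t) ≤
      -(κ - η) * ‖X.s P t‖ ^ 2 + (Φ + η) * ‖X.s P t‖) :
    LimsupLe (fun t => ‖X.s P t‖) (√(P.lamR / P.lamL) * Φ / κ) := by
  refine limsupLe_of_forall (fun t => norm_nonneg _) fun d hd => ?_
  have hL := hP.lamL_pos
  have hR : 0 < P.lamR := hL.trans_le hP.lamL_le_lamR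
  obtain ⟨η, hη, hηκ, hηd⟩ : ∃ η > 0, η < κ ∧
      √(P.lamR / P.lamL) * ((Φ + 2 * η) / (κ - η)) < √(P.lamR / P.lamL) * Φ / κ + d := by
    have hc : ContinuousAt (fun η => √(P.lamR / P.lamL) * ((Φ + 2 * η) / (κ - η))) 0 := by
      have : κ - 0 ≠ 0 := by simpa using hκ.ne'
      fun_prop (disch := assumption)
    have h1 : ∀ᶠ η in 𝓝[>] (0 : ℝ),
        √(P.lamR / P.lamL) * ((Φ + 2 * η) / (κ - η)) < √(P.lamR / P.lamL) * Φ / κ + d := by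
      refine nhdsWithin_le_nhds (hc.eventually (gt_mem_nhds ?_))
      simp only [mul_zero, add_zero, sub_zero, ← mul_div_assoc]
      linarith
    have h2 : ∀ᶠ η in 𝓝[>] (0 : ℝ), η < κ := nhdsWithin_le_nhds (gt_mem_nhds hκ)
    obtain ⟨η, h3, h4, h5⟩ := (h1.and (h2.and self_mem_nhdsWithin)).exists
    exact ⟨η, h5, h4, h3⟩
  set c := (Φ + 2 * η) / (κ - η) with hcdef
  have hκη : 0 < κ - η := sub_pos.2 hηκ
  have hc : 0 < c := div_pos (by linarith) hκη
  obtain ⟨T, hT⟩ := eventually_atTop.1 (h η hη)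
  have hub (t : ℝ) : X.energy P t ≤ P.lamR * ‖X.s P t‖ ^ 2 :=
    (le_lamMax_mul hX.J_symm _).trans (by gcongr; exact hX.le_lamR)
  have hlb (t : ℝ) : P.lamL * ‖X.s P t‖ ^ 2 ≤ X.energy P t :=
    le_trans (by gcongr; exact hX.lamL_le) (lamMin_mul_le hX.J_symm _)
  have hcont : ContinuousOn (X.energy P) (Set.Ici (max T 0)) := by
    have h1 : ContinuousOn (X.s P) (Set.Ici (max T 0)) :=
      (continuousOn_s hP hX hcl).mono (Set.Ici_subset_Ici.2 (le_max_right _ _))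
    exact h1.inner ((LinearMap.toContinuousLinearMap
      (Matrix.toEuclideanLin X.J)).continuous.comp_continuousOn h1)
  -- above the level `λ_r c²` of the energy `‖s‖ > c`, and the energy decreases at rate `2 c η`
  have hev : ∀ᶠ t in atTop, X.energy P t ≤ P.lamR * c ^ 2 := by
    refine eventually_le_of_decrease (η := 2 * (c * η)) hcont (by positivity)
      fun a b ha hab hlt => ?_
    have hTa := (le_max_left _ _).trans ha
    have h0a := (le_max_right _ _).trans ha
    rcases hab.eq_or_lt with rfl | hab'
    · simp
    have hb : 0 < b := h0a.trans_lt hab'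
    refine sub_le_of_absolutelyContinuous hab
      ((absolutelyContinuous_energy hP hX hcl hb).mono ?_) ?_
    · rw [Set.uIcc_of_le hab, Set.uIcc_of_le hb.le]
      exact Set.Icc_subset_Icc h0a le_rfl
    filter_upwards [deriv_energy (P := P) hX hcl] with t ht hmem
    rw [ht (h0a.trans_lt hmem.1)]
    have h1 := hT t (hTa.trans hmem.1.le)
    have h2 : c < ‖X.s P t‖ := by
      have h3 := (hlt t hmem).trans_le (hub t)
      exact lt_of_pow_lt_pow_left₀ 2 (norm_nonneg _) (lt_of_mul_lt_mul_left h3 hR.le)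
    have h4 : (κ - η) * c = Φ + 2 * η := by rw [hcdef]; field_simp
    have h5 : η ≤ (κ - η) * ‖X.s P t‖ - (Φ + η) := by
      have := mul_le_mul_of_nonneg_left h2.le hκη.le
      linarith
    have h6 := mul_le_mul h2.le h5 hη.le (norm_nonneg _)
    linarith
  filter_upwards [hev] with t ht
  have h1 := (hlb t).trans ht
  have h2 : ‖X.s P t‖ ≤ √(P.lamR / P.lamL) * c := by
    apply le_of_sq_le_sq _ (by positivity)
    rw [mul_pow, Real.sq_sqrt (by positivity), div_mul_eq_mul_div, le_div_iff₀ hL]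
    linarith
  exact h2.trans hηd.le

/-- On the sliding surface the attitude error is contracted, so an ultimate bound on `s` yields one
on the vector part of the attitude error, whichever equilibrium the error approaches. -/
lemma limsupLe_qe (hP : P.Valid) (hX : Assumptions P X) (hcl : IsClosedLoop P X) {σ : ℝ}
    (hs : LimsupLe (fun t => ‖X.s P t‖) σ) (hσ0 : 0 ≤ σ) (hσ : P.k⁻¹ * σ < 1) :
    LimsupLe (fun t => ‖vec (X.qe t)‖) (P.k⁻¹ * σ) := by
  refine limsupLe_of_forall (fun t => norm_nonneg _) fun d hd => ?_
  have hk := hP.k_pos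
  obtain ⟨c, hc1, hc2⟩ := exists_between (lt_min hσ (by linarith : P.k⁻¹ * σ < P.k⁻¹ * σ + d))
  obtain ⟨c', hc'1, hc'2⟩ := exists_between hc1
  have hc'0 : 0 < c' ∨ 0 = c' := (lt_or_eq_of_le ((by positivity : 0 ≤ P.k⁻¹ * σ).trans hc'1.le))
  have hc0 : 0 < c := by rcases hc'0 with h | h <;> linarith
  have hlt1 : c < 1 := hc2.trans_le (min_le_left _ _)
  have hsc : σ < P.k * c' := by
    rw [inv_mul_lt_iff₀ hk] at hc'1; exact hc'1
  obtain ⟨T, hT⟩ := eventually_atTop.1 (hs.eventually_le hsc)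
  have hnorm (t : ℝ) (ht : 0 ≤ t) : (X.qe t).re ^ 2 + ‖vec (X.qe t)‖ ^ 2 = 1 := by
    rw [← quat_norm_sq, qe_unit hX hcl ht, one_pow]
  have hr : 0 < √(1 - c ^ 2) := Real.sqrt_pos.2 (by nlinarith)
  have hev : ∀ᶠ t in atTop, √(1 - c ^ 2) ≤ |(X.qe t).re| := by
    refine eventually_le_abs (g' := fun t => (kin (X.qe t) (X.we t)).re) (T := max T 0)
      (δ := 1 / 2 * (P.k * (c * (c - c')))) hr
      (mul_pos (by norm_num) (mul_pos hk (mul_pos hc0 (by linarith)))) (fun t ht => ?_)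
      fun t ht hlt => ?_
    · exact ((reL.hasFDerivAt.comp_hasDerivWithinAt t (hasDerivWithinAt_qe hX hcl
        ((le_max_right _ _).trans ht))).mono (Set.Ici_subset_Ici.2 (le_max_right _ _)))
    · have ht0 := (le_max_right _ _).trans ht
      have h1 := hT t ((le_max_left _ _).trans ht)
      have h2 : c ≤ ‖vec (X.qe t)‖ := by
        apply le_of_sq_le_sq _ (norm_nonneg _)
        have h3 := hnorm t ht0
        have h4 := (sq_lt_sq₀ (abs_nonneg _) hr.le).2 hlt
        rw [sq_abs, Real.sq_sqrt (by nlinarith)] at h4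
        linarith
      have e : (kin (X.qe t) (X.we t)).re =
          1 / 2 * (P.k * ‖vec (X.qe t)‖ ^ 2 - inner ℝ (vec (X.qe t)) (X.s P t)) := by
        rw [kin, quat_re, s, inner_add_right, inner_smul_right, real_inner_self_eq_norm_sq]
        ring
      have h3 := (real_inner_le_norm (vec (X.qe t)) (X.s P t)).trans
        (mul_le_mul_of_nonneg_left h1 (norm_nonneg _))
      have h4 : c * (c - c') ≤ ‖vec (X.qe t)‖ * (‖vec (X.qe t)‖ - c') :=
        mul_le_mul h2 (by linarith) (by linarith) (norm_nonneg _)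
      have h5 := mul_le_mul_of_nonneg_left h4 hk.le
      rw [e]
      linarith
  filter_upwards [hev, eventually_ge_atTop 0] with t ht ht0
  have h1 := hnorm t ht0
  have h2 : ‖vec (X.qe t)‖ ≤ c := by
    apply le_of_sq_le_sq _ hc0.le
    have h4 := (sq_le_sq₀ hr.le (abs_nonneg _)).2 ht
    rw [sq_abs, Real.sq_sqrt (by nlinarith)] at h4
    linarith
  exact h2.trans (hc2.le.trans (min_le_right _ _))

lemma limsupLe_we (hP : P.Valid) {σ : ℝ} (hs : LimsupLe (fun t => ‖X.s P t‖) σ)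
    (hq : LimsupLe (fun t => ‖vec (X.qe t)‖) (P.k⁻¹ * σ)) :
    LimsupLe (fun t => ‖X.we t‖) (2 * σ) := by
  refine limsupLe_of_forall (fun t => norm_nonneg _) fun d hd => ?_
  have hk := hP.k_pos
  have h1 : P.k⁻¹ * σ < P.k⁻¹ * (σ + d / 2) := by gcongr; linarith
  filter_upwards [hs.eventually_le (by linarith : σ < σ + d / 2), hq.eventually_le h1] with t h2 h3
  have h4 := norm_we_le (X := X) (t := t) hP
  have h5 := mul_le_mul_of_nonneg_left h3 hk.le
  rw [mul_inv_cancel_left₀ hk.ne'] at h5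
  linarith

/-- The observer errors eventually satisfy every relaxation of their ultimate bounds. The scalar part
of `q̃` cannot vanish once its vector part is shorter than `1`, so by continuity its sign is
eventually constant, and it is positive because the upper limit is. -/
lemma eventually_accurate (hP : P.Valid) (hX : Assumptions P X) (hcl : IsClosedLoop P X) {δ : ℝ}
    (hδ : 0 < δ) : ∀ᶠ t in atTop, X.Accurate P t δ := by
  have hpos : 0 < √(1 - P.ρq ^ 2) := by
    apply Real.sqrt_pos.2
    nlinarith [hP.ρq_nonneg, hP.ρq_lt_one]
  obtain ⟨c, hc1, hc2⟩ := exists_between hP.ρq_lt_one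
  obtain ⟨T, hT⟩ := eventually_atTop.1 (hX.qtil_limsup.eventually_le hc1)
  have hne : ∀ t, max T 0 ≤ t → (X.qtil t).re ≠ 0 := fun t ht h0 => by
    have ht0 := (le_max_right _ _).trans ht
    have h1 := quat_norm_sq (X.qtil t)
    rw [qtil, norm_star_mul (hX.qhat_unit t ht0) (hcl.q_unit t ht0), ← qtil, h0] at h1
    have h2 := hT t ((le_max_left _ _).trans ht)
    nlinarith [norm_nonneg (vec (X.qtil t))]
  have hcont : ContinuousOn (fun t => (X.qtil t).re) (Set.Ici (max T 0)) :=
    reL.continuous.comp_continuousOn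
      (hX.qtil_cont.mono (Set.Ici_subset_Ici.2 (le_max_right _ _)))
  have hb : IsCoboundedUnder (· ≤ ·) atTop fun t => (X.qtil t).re := by
    refine (isBoundedUnder_of_eventually_ge (a := -1) ?_).isCoboundedUnder_le
    filter_upwards [eventually_ge_atTop 0] with t ht
    have h1 := quat_norm_sq (X.qtil t)
    rw [qtil, norm_star_mul (hX.qhat_unit t ht) (hcl.q_unit t ht), ← qtil] at h1
    nlinarith [sq_nonneg ‖vec (X.qtil t)‖]
  have hfreq : ∃ᶠ t in atTop, 0 < (X.qtil t).re :=
    frequently_lt_of_lt_limsup hb (hpos.trans_le hX.qtil0_limsup)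
  obtain ⟨t₁, ht₁, ht₁T⟩ := (hfreq.and_eventually (eventually_ge_atTop (max T 0))).exists
  have hre : ∀ t, t₁ ≤ t → 0 ≤ (X.qtil t).re := fun t ht => by
    by_contra! hneg
    obtain ⟨z, hz, hz0⟩ := intermediate_value_Icc' ht
      (hcont.mono fun x hx => ht₁T.trans hx.1) ⟨hneg.le, ht₁.le⟩
    exact hne z (ht₁T.trans hz.1) hz0
  filter_upwards [eventually_ge_atTop t₁, eventually_ge_atTop 0,
    hX.qtil_limsup.eventually_le (lt_add_of_pos_right P.ρq hδ),
    hX.wtil_limsup.eventually_le (lt_add_of_pos_right P.ρw hδ)] with t h1 h2 h3 h4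
  exact ⟨h2, hδ.le, h3, hre t h1, h4⟩

/-- Turns an estimate with relaxed constants into an asymptotic one. -/
lemma limsupLe_s_of_relax (hP : P.Valid) (hX : Assumptions P X) (hcl : IsClosedLoop P X) {x : ℝ}
    (hx : LimsupLe (fun t => ‖vec (X.qe t)‖) x) {κ Φ : ℝ → ℝ} (hκc : Continuous κ)
    (hΦc : Continuous Φ) (hκ : 0 < κ 0) (hΦ : 0 ≤ Φ 0)
    (h : ∀ᶠ t in atTop, ∀ δ, X.Accurate P t δ → ‖vec (X.qe t)‖ ≤ x + δ →
      inner ℝ (X.s P t) (X.netTorque P t) ≤ -κ δ * ‖X.s P t‖ ^ 2 + Φ δ * ‖X.s P t‖) :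
    LimsupLe (fun t => ‖X.s P t‖) (√(P.lamR / P.lamL) * Φ 0 / κ 0) := by
  refine limsupLe_s hP hX hcl hκ hΦ fun η hη => ?_
  have h1 : ∀ᶠ δ in 𝓝[>] (0 : ℝ), κ 0 - η < κ δ :=
    nhdsWithin_le_nhds (hκc.continuousAt.eventually (lt_mem_nhds (by linarith)))
  have h2 : ∀ᶠ δ in 𝓝[>] (0 : ℝ), Φ δ < Φ 0 + η :=
    nhdsWithin_le_nhds (hΦc.continuousAt.eventually (gt_mem_nhds (by linarith)))
  obtain ⟨δ, hδ1, hδ2, hδ⟩ := (h1.and (h2.and self_mem_nhdsWithin)).exists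
  filter_upwards [h, eventually_accurate hP hX hcl hδ,
    hx.eventually_le (lt_add_of_pos_right x hδ)] with t h3 h4 h5
  refine (h3 δ h4 h5).trans ?_
  gcongr

/-- One step of the first recursion. -/
lemma limsupLe_s_step (hP : P.Valid) (hX : Assumptions P X) (hcl : IsClosedLoop P X) {x : ℝ}
    (hx0 : 0 ≤ x) (hx : LimsupLe (fun t => ‖vec (X.qe t)‖) x) :
    LimsupLe (fun t => ‖X.s P t‖) (P.step x) := by
  have h := limsupLe_s_of_relax hP hX hcl hx P.continuous_κ
    ((P.continuous_φbar x).add P.continuous_slack)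
    (by simpa [Params.relax_zero] using hP.κ_pos)
    (by simpa [Params.relax_zero, Params.slack, Params.φbar] using
      Or.inr (hP.signed.φ2_nonneg hx0))
    (Eventually.of_forall fun t δ h1 h2 => h1.power_le hP hX hcl h2)
  simpa [Params.relax_zero, Params.slack, Params.step] using h

/-- One step of the second recursion, once the trajectory stays in the boundary layer. -/
lemma limsupLe_s_step' (hP : P.Valid) (hX : Assumptions P X) (hcl : IsClosedLoop P X)
    (hlayer : ∀ᶠ t in atTop, ‖X.shat P t‖ < P.ε) {x : ℝ}
    (hx0 : 0 ≤ x) (hx : LimsupLe (fun t => ‖vec (X.qe t)‖) x) :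
    LimsupLe (fun t => ‖X.s P t‖) (P.step' x) := by
  have hd : 0 ≤ P.ε⁻¹ * (P.a1 * P.γ + P.a0) := by
    have := hP.signed.a1_nonneg; have := hP.signed.a0_nonneg; have := hP.γ_pos
    have := hP.ε_pos
    positivity
  have h := limsupLe_s_of_relax hP hX hcl hx
    (P.continuous_κ.add (continuous_const (y := P.ε⁻¹ * (P.a1 * P.γ + P.a0))))
    (P.continuous_φ2 x)
    (by simpa [Params.relax_zero] using add_pos_of_pos_of_nonneg (hP.κ_pos) hd)
    (by simpa [Params.relax_zero] using hP.signed.φ2_nonneg hx0)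
    (hlayer.mono fun t ht δ h1 h2 => h1.power_le_of_lt hP hX hcl h2 ht)
  simpa [Params.relax_zero, Params.step', Params.κ'] using h

/-- If `s` is ultimately smaller than `ε - ρ_s`, the trajectory stays in the boundary layer. -/
lemma eventually_shat_lt (hP : P.Valid) (hX : Assumptions P X) (hcl : IsClosedLoop P X) {σ : ℝ}
    (hs : LimsupLe (fun t => ‖X.s P t‖) σ) (hσ : σ + P.ρs < P.ε) :
    ∀ᶠ t in atTop, ‖X.shat P t‖ < P.ε := by
  have h1 : ∀ᶠ δ in 𝓝[>] (0 : ℝ), σ + δ + (P.relax δ).ρs < P.ε := by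
    have hc : Continuous fun δ => σ + δ + (P.relax δ).ρs := by
      have := P.continuous_ρs
      fun_prop
    refine nhdsWithin_le_nhds (hc.continuousAt.eventually (gt_mem_nhds ?_))
    simpa [Params.relax_zero] using hσ
  obtain ⟨δ, hδ1, hδ⟩ := (h1.and self_mem_nhdsWithin).exists
  filter_upwards [eventually_accurate hP hX hcl hδ,
    hs.eventually_le (lt_add_of_pos_right σ hδ)] with t h2 h3
  have h4 := h2.norm_shat_sub_s hP hX hcl
  have h5 := norm_le_norm_add_norm_sub' (X.shat P t) (X.s P t)
  linarith

end Trajectory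

/-! ### The recursions for the ultimate bounds -/

lemma recursion_nonneg {f : ℝ → ℝ} {u : ℕ → ℝ} (hf : ∀ x, 0 ≤ x → 0 ≤ f x)
    (hu : ∀ n, u (n + 1) = f (u n)) (h0 : 0 ≤ u 0) (n : ℕ) : 0 ≤ u n := by
  induction n with
  | zero => exact h0
  | succ n ih => rw [hu]; exact hf _ ih

lemma recursion_antitone {f : ℝ → ℝ} {u : ℕ → ℝ} (hf : ∀ x, 0 ≤ x → 0 ≤ f x)
    (hmono : MonotoneOn f (Set.Ici 0)) (hu : ∀ n, u (n + 1) = f (u n)) (h0 : 0 ≤ u 0)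
    (h1 : u 1 ≤ u 0) : Antitone u := by
  refine antitone_nat_of_succ_le fun n => ?_
  induction n with
  | zero => exact h1
  | succ n ih =>
    rw [hu (n + 1)]
    nth_rewrite 2 [hu n]
    exact hmono (recursion_nonneg hf hu h0 _) (recursion_nonneg hf hu h0 _) ih

lemma recursion_strictAnti {f : ℝ → ℝ} {u : ℕ → ℝ} (hf : ∀ x, 0 ≤ x → 0 ≤ f x)
    (hmono : StrictMonoOn f (Set.Ici 0)) (hu : ∀ n, u (n + 1) = f (u n)) (h0 : 0 ≤ u 0)
    (h1 : u 1 < u 0) : StrictAnti u := by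
  refine strictAnti_nat_of_succ_lt fun n => ?_
  induction n with
  | zero => exact h1
  | succ n ih =>
    rw [hu (n + 1)]
    nth_rewrite 2 [hu n]
    exact hmono (recursion_nonneg hf hu h0 _) (recursion_nonneg hf hu h0 _) ih

lemma exists_tendsto_of_antitone {u : ℕ → ℝ} (hu : Antitone u) (h0 : ∀ n, 0 ≤ u n) :
    ∃ l, 0 ≤ l ∧ Tendsto u atTop (𝓝 l) ∧ ∀ n, l ≤ u n := by
  have hb : BddBelow (Set.range u) := ⟨0, by rintro _ ⟨n, rfl⟩; exact h0 n⟩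
  exact ⟨_, le_ciInf h0, tendsto_atTop_ciInf hu hb, fun n => ciInf_le hb n⟩

lemma limsupLe_of_tendsto {f : ℝ → ℝ} {u : ℕ → ℝ} {c : ℝ} (hu : Tendsto u atTop (𝓝 c))
    (h : ∀ᶠ n in atTop, LimsupLe f (u n)) : LimsupLe f c :=
  ⟨h.exists.choose_spec.1, ge_of_tendsto hu (h.mono fun _ hn => hn.2)⟩

namespace Params

variable {P : Params}

lemma Valid.ratio_pos (hP : P.Valid) : 0 < √(P.lamR / P.lamL) :=
  Real.sqrt_pos.2 (div_pos (hP.lamL_pos.trans_le hP.lamL_le_lamR) hP.lamL_pos)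

lemma Valid.κ_le_κ' (hP : P.Valid) : P.κ ≤ P.κ' := by
  have := hP.signed.a1_nonneg; have := hP.signed.a0_nonneg; have := hP.γ_pos
  have := hP.ε_pos
  have : 0 ≤ P.ε⁻¹ * (P.a1 * P.γ + P.a0) := by positivity
  unfold κ'; linarith

lemma Valid.step_nonneg (hP : P.Valid) {x : ℝ} (hx : 0 ≤ x) : 0 ≤ P.step x := by
  have h1 : 0 ≤ P.φbar x 0 := (hP.signed.φ2_nonneg hx).trans (le_max_right _ _)
  have := hP.κ_pos
  unfold step; positivity

lemma Valid.step'_nonneg (hP : P.Valid) {x : ℝ} (hx : 0 ≤ x) : 0 ≤ P.step' x := by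
  have h1 := hP.signed.φ2_nonneg hx
  have := hP.κ_pos.trans_le hP.κ_le_κ'
  unfold step'; positivity

lemma Valid.step_mono (hP : P.Valid) : MonotoneOn P.step (Set.Ici 0) := fun x hx y _ hxy => by
  have := hP.signed.φbar_mono hx hxy
  have := hP.κ_pos
  unfold step; gcongr

lemma Valid.step'_mono (hP : P.Valid) : MonotoneOn P.step' (Set.Ici 0) := fun x hx y _ hxy => by
  have := hP.signed.φ2_mono hx hxy
  have := hP.κ_pos.trans_le hP.κ_le_κ'
  unfold step'; gcongr

lemma Valid.step'_le_step (hP : P.Valid) {x : ℝ} (hx : 0 ≤ x) : P.step' x ≤ P.step x := by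
  have h1 : P.φ2 x 0 ≤ P.φbar x 0 := le_max_right _ _
  have h2 := (hP.signed.φ2_nonneg hx).trans h1
  have h3 := hP.κ_pos
  have h4 := hP.κ_le_κ'
  unfold step step'; gcongr

/-- The additional damping in the boundary layer improves a nonzero bound strictly. -/
lemma Valid.step'_lt_step (hP : P.Valid) {x : ℝ} (hpos : 0 < P.step x)
    (hd : 0 < P.a1 * P.γ + P.a0) : P.step' x < P.step x := by
  have h1 : P.φ2 x 0 ≤ P.φbar x 0 := le_max_right _ _
  have h3 := hP.κ_pos
  have h4 : P.κ < P.κ' := by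
    have := mul_pos (inv_pos.2 hP.ε_pos) hd
    unfold κ'; linarith
  have h5 := hP.ratio_pos
  have h6 : 0 < √(P.lamR / P.lamL) * P.φbar x 0 := by
    have : P.step x * P.κ = √(P.lamR / P.lamL) * P.φbar x 0 := by
      unfold step; field_simp
    rw [← this]; positivity
  have h7 := h3.trans h4
  calc P.step' x ≤ √(P.lamR / P.lamL) * P.φbar x 0 / P.κ' := by unfold step'; gcongr
    _ < P.step x := div_lt_div_of_pos_left h6 h3 h4

/-- `φ₂` is a quadratic polynomial in `x` with nonnegative coefficients; if some uncertainty in the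
attitude, the inertia or the actuators is present, it is not constant. -/
lemma Valid.step'_strictMono (hP : P.Valid) (hJ : 0 < ‖P.Jhat‖ ∨ 0 < P.ρJ)
    (h : 0 < P.ρq ∨ 0 < P.ρJ ∨ 0 < P.ρE) : StrictMonoOn P.step' (Set.Ici 0) := by
  intro x hx y _ hxy
  have h1 := hP.ratio_pos
  have h2 := hP.κ_pos.trans_le hP.κ_le_κ'
  have hk := hP.k_pos
  suffices hφ : P.φ2 x 0 < P.φ2 y 0 by unfold step'; gcongr
  have hx0 : 0 ≤ x := hx
  have ha2 := hP.signed.a2_nonneg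
  have hb2 := mul_nonneg hP.ρE_nonneg hP.signed.b2_nonneg
  have ha1 := hP.signed.a1_nonneg
  have hb1 := mul_nonneg hP.ρE_nonneg hP.signed.b1_nonneg
  have hc : 0 ≤ P.ε⁻¹ * P.a1 * P.ρs := by
    have := hP.ε_pos; have := hP.signed.ρs_nonneg
    positivity
  have hcoef : 0 < P.a2 + P.ρE * P.b2 ∨ 0 < P.ε⁻¹ * P.a1 * P.ρs + P.a1 + P.ρE * P.b1 := by
    by_cases hρJ : 0 < P.ρJ
    · left
      have : 0 < P.a2 := by unfold a2; positivity
      linarith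
    · have hn := hJ.resolve_right hρJ
      rcases h with h | h | h
      · right
        have h0 : 0 < P.ρ0 := by
          have h3 : √(1 - P.ρq ^ 2) < 1 := by
            rw [Real.sqrt_lt' one_pos]; nlinarith
          exact Real.sqrt_pos.2 (by linarith)
        have h4 : 0 < P.k ^ 2 * P.ρ0 * ‖P.Jhat‖ := by positivity
        have h5 : P.k ^ 2 * P.ρ0 * ‖P.Jhat‖ ≤ P.a1 := by
          have := hP.signed.a3_nonneg; have := hP.ρv_nonneg; have := hP.ρJ_nonneg
          have h6 : 0 ≤ P.k * P.a3 := by positivity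
          have h7 : 0 ≤ 3 * P.k * P.ρv * (P.ρJ + 2 * P.ρq * ‖P.Jhat‖) := by positivity
          unfold a1; linarith
        linarith
      · exact absurd h hρJ
      · left
        have : 0 < P.ρE * P.b2 := by unfold b2; positivity
        linarith
  have hsq : x ^ 2 < y ^ 2 := by gcongr
  simp only [φ2, add_zero]
  rcases hcoef with h | h
  · have h3 := mul_lt_mul_of_pos_left hsq h
    have h4 := mul_le_mul_of_nonneg_left hxy.le
      (by linarith : 0 ≤ P.ε⁻¹ * P.a1 * P.ρs + P.a1 + P.ρE * P.b1)
    linarith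
  · have h3 := mul_lt_mul_of_pos_left hxy h
    have h4 := mul_le_mul_of_nonneg_left hsq.le (by linarith : 0 ≤ P.a2 + P.ρE * P.b2)
    linarith

lemma continuous_step (P : Params) : Continuous P.step := by
  unfold step φbar φ1 φ2; fun_prop

lemma continuous_step' (P : Params) : Continuous P.step' := by
  unfold step' φ2; fun_prop

lemma Valid.qbar_nonneg (hP : P.Valid) (i : ℕ) : 0 ≤ P.qbar i :=
  recursion_nonneg (f := fun x => P.k⁻¹ * P.step x)
    (fun _ hx => mul_nonneg (inv_nonneg.2 hP.k_pos.le) (hP.step_nonneg hx)) (fun _ => rfl)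
    zero_le_one i

lemma Valid.qbar_antitone (hP : P.Valid) (h : P.qbar 1 < 1) : Antitone P.qbar :=
  recursion_antitone (f := fun x => P.k⁻¹ * P.step x)
    (fun _ hx => mul_nonneg (inv_nonneg.2 hP.k_pos.le) (hP.step_nonneg hx))
    (fun _ hx _ hy hxy =>
      mul_le_mul_of_nonneg_left (hP.step_mono hx hy hxy) (inv_nonneg.2 hP.k_pos.le)) (fun _ => rfl) zero_le_one h.le

lemma Valid.qbar'_nonneg (hP : P.Valid) {x : ℝ} (hx : 0 ≤ x) (i : ℕ) : 0 ≤ P.qbar' x i :=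
  recursion_nonneg (f := fun x => P.k⁻¹ * P.step' x)
    (fun _ hx => mul_nonneg (inv_nonneg.2 hP.k_pos.le) (hP.step'_nonneg hx)) (fun _ => rfl) hx i

lemma Valid.qbar'_antitone (hP : P.Valid) {x : ℝ} (hx : 0 ≤ x) (h : P.k⁻¹ * P.step' x ≤ x) :
    Antitone (P.qbar' x) :=
  recursion_antitone (f := fun x => P.k⁻¹ * P.step' x)
    (fun _ hx => mul_nonneg (inv_nonneg.2 hP.k_pos.le) (hP.step'_nonneg hx))
    (fun _ hx _ hy hxy =>
      mul_le_mul_of_nonneg_left (hP.step'_mono hx hy hxy) (inv_nonneg.2 hP.k_pos.le)) (fun _ => rfl) hx h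

lemma Valid.sbar_eq (hP : P.Valid) {i : ℕ} (hi : 1 ≤ i) : P.sbar i = P.k * P.qbar i := by
  obtain ⟨n, rfl⟩ := Nat.exists_eq_add_of_le' hi
  exact (mul_inv_cancel_left₀ hP.k_pos.ne' _).symm

lemma Valid.sbar'_eq (hP : P.Valid) (x : ℝ) {i : ℕ} (hi : 1 ≤ i) :
    P.sbar' x i = P.k * P.qbar' x i := by
  obtain ⟨n, rfl⟩ := Nat.exists_eq_add_of_le' hi
  exact (mul_inv_cancel_left₀ hP.k_pos.ne' _).symm

lemma tendsto_sub_one {u : ℕ → ℝ} {l : ℝ} (h : Tendsto u atTop (𝓝 l)) :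
    Tendsto (fun i => u (i - 1)) atTop (𝓝 l) :=
  (tendsto_add_atTop_iff_nat 1).1 (by simpa using h)

end Params

namespace Trajectory

variable {m : ℕ} {X : Trajectory m} {P : Params}

/-- The bounds of the first recursion. -/
lemma limsupLe_qbar (hP : P.Valid) (hX : Assumptions P X) (hcl : IsClosedLoop P X)
    (hq1 : P.qbar 1 < 1) (i : ℕ) : LimsupLe (fun t => ‖vec (X.qe t)‖) (P.qbar i) := by
  induction i with
  | zero =>
    refine limsupLe_of_forall (fun t => norm_nonneg _) fun d hd => ?_
    filter_upwards [eventually_ge_atTop 0] with t ht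
    have h1 := norm_vec_qe_le hX hcl ht
    change _ ≤ 1 + d
    linarith
  | succ i ih =>
    refine limsupLe_qe hP hX hcl (limsupLe_s_step hP hX hcl (hP.qbar_nonneg i) ih)
      (hP.step_nonneg (hP.qbar_nonneg i)) ?_
    exact (hP.qbar_antitone hq1 (Nat.le_add_left 1 i)).trans_lt hq1

/-- The bounds of the second recursion. -/
lemma limsupLe_qbar' (hP : P.Valid) (hX : Assumptions P X) (hcl : IsClosedLoop P X)
    (hlayer : ∀ᶠ t in atTop, ‖X.shat P t‖ < P.ε) {x : ℝ} (hx0 : 0 ≤ x) (hx1 : x < 1)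
    (hx : LimsupLe (fun t => ‖vec (X.qe t)‖) x) (hstep : P.k⁻¹ * P.step' x ≤ x) (i : ℕ) :
    LimsupLe (fun t => ‖vec (X.qe t)‖) (P.qbar' x i) := by
  induction i with
  | zero => exact hx
  | succ i ih =>
    refine limsupLe_qe hP hX hcl
      (limsupLe_s_step' hP hX hcl hlayer (hP.qbar'_nonneg hx0 i) ih)
      (hP.step'_nonneg (hP.qbar'_nonneg hx0 i)) ?_
    exact (hP.qbar'_antitone hx0 hstep (Nat.zero_le (i + 1))).trans_lt hx1

lemma norm_Jhat_pos_or (hP : P.Valid) (hX : Assumptions P X) : 0 < ‖P.Jhat‖ ∨ 0 < P.ρJ := by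
  by_contra! hcon
  have h1 : P.Jhat = 0 := norm_le_zero_iff.1 hcon.1
  have h2 := hX.Jtil_le.trans hcon.2
  rw [h1, zero_sub, norm_neg] at h2
  have h3 : X.J = 0 := norm_le_zero_iff.1 h2
  have h4 := lamMin_mul_le hX.J_symm (EuclideanSpace.single 0 1)
  have h5 := hX.lamL_le
  have h6 := hP.lamL_pos
  rw [h3] at h4 h5
  simp [act] at h4
  linarith

end Trajectory
end AttitudeTracking

open AttitudeTracking in
theorem mainTheorem2 {m : ℕ} (P : AttitudeTracking.Params) (X : AttitudeTracking.Trajectory m)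
    (hP : P.Valid) (hX : AttitudeTracking.Assumptions P X)
    (hcl : AttitudeTracking.IsClosedLoop P X) (hq1 : P.qbar 1 < 1) :
    ∃ sLim qLim : ℝ, Tendsto P.sbar atTop (𝓝 sLim) ∧ Tendsto P.qbar atTop (𝓝 qLim) ∧
      (sLim + P.ρs < P.ε →
        -- the trajectory eventually stays inside the boundary layer
        (∃ T, ∀ t, T ≤ t → ‖X.shat P t‖ < P.ε) ∧
        -- ultimate bounds
        (∀ i, 1 ≤ i → AttitudeTracking.ErrorBounds P X (P.sbar' qLim i) (P.qbar' qLim i)) ∧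
        -- monotonicity, convergence and comparison with the first pair of sequences
        Antitone (P.qbar' qLim) ∧ AntitoneOn (P.sbar' qLim) (Set.Ici 1) ∧
        (∃ sLim' qLim' : ℝ, 0 ≤ sLim' ∧ 0 ≤ qLim' ∧
          Tendsto (P.sbar' qLim) atTop (𝓝 sLim') ∧ Tendsto (P.qbar' qLim) atTop (𝓝 qLim') ∧
          AttitudeTracking.ErrorBounds P X sLim' qLim') ∧
        (∀ i j, 1 ≤ i → 1 ≤ j →
          P.sbar' qLim i ≤ P.sbar j ∧ P.qbar' qLim i ≤ P.qbar j) ∧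
        -- strictness when the uncertainties are nonzero
        (0 < qLim → 0 < P.a1 * P.γ + P.a0 → (0 < P.ρq ∨ 0 < P.ρJ ∨ 0 < P.ρE) →
          StrictAnti (P.qbar' qLim) ∧ StrictAntiOn (P.sbar' qLim) (Set.Ici 1) ∧
          ∀ i j, 1 ≤ i → 1 ≤ j →
            P.sbar' qLim i < sLim ∧ P.qbar' qLim i < qLim ∧
            P.sbar' qLim i < P.sbar j ∧ P.qbar' qLim i < P.qbar j)) := by
  have hk := hP.k_pos
  obtain ⟨qLim, hq0, hqt, hqle⟩ :=
    exists_tendsto_of_antitone (hP.qbar_antitone hq1) hP.qbar_nonneg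
  have hst : Tendsto P.sbar atTop (𝓝 (P.step qLim)) :=
    Params.tendsto_sub_one ((P.continuous_step.tendsto qLim).comp hqt)
  -- the limit is a fixed point of the first recursion
  have hfix : P.k⁻¹ * P.step qLim = qLim :=
    tendsto_nhds_unique (((P.continuous_step.tendsto qLim).comp hqt).const_mul P.k⁻¹)
      ((tendsto_add_atTop_iff_nat 1).2 hqt)
  have hsLim : P.step qLim = P.k * qLim := by
    rw [← hfix, mul_inv_cancel_left₀ hk.ne', hfix]
  have hqe : LimsupLe (fun t => ‖vec (X.qe t)‖) qLim :=
    limsupLe_of_tendsto hqt (Eventually.of_forall (Trajectory.limsupLe_qbar hP hX hcl hq1))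
  refine ⟨P.step qLim, qLim, hst, hqt, fun hlt => ?_⟩
  have hlayer := Trajectory.eventually_shat_lt hP hX hcl
    (Trajectory.limsupLe_s_step hP hX hcl hq0 hqe) hlt
  have hstep : P.k⁻¹ * P.step' qLim ≤ qLim := by
    calc P.k⁻¹ * P.step' qLim ≤ P.k⁻¹ * P.step qLim := by
          gcongr; exact hP.step'_le_step hq0
      _ = qLim := hfix
  have hanti := hP.qbar'_antitone hq0 hstep
  have hqn := hP.qbar'_nonneg hq0
  have hbounds : ∀ i, 1 ≤ i → ErrorBounds P X (P.sbar' qLim i) (P.qbar' qLim i) := by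
    intro i hi
    obtain ⟨n, rfl⟩ := Nat.exists_eq_add_of_le' hi
    have hq := Trajectory.limsupLe_qbar' hP hX hcl hlayer hq0 ((hqle 1).trans_lt hq1) hqe hstep
    have hs := Trajectory.limsupLe_s_step' hP hX hcl hlayer (hqn n) (hq n)
    exact ⟨hs, hq (n + 1), Trajectory.limsupLe_we hP hs (hq (n + 1))⟩
  obtain ⟨qLim', hq'0, hq't, -⟩ := exists_tendsto_of_antitone hanti hqn
  have hs't : Tendsto (P.sbar' qLim) atTop (𝓝 (P.step' qLim')) :=
    Params.tendsto_sub_one ((P.continuous_step'.tendsto qLim').comp hq't)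
  have hcomp : ∀ i j, 1 ≤ i → 1 ≤ j → P.qbar' qLim i ≤ P.qbar j := fun i j _ _ =>
    (hanti (Nat.zero_le i)).trans (hqle j)
  have hev : ∀ᶠ i : ℕ in atTop, 1 ≤ i := eventually_ge_atTop 1
  refine ⟨eventually_atTop.1 hlayer, hbounds, hanti, fun i hi j hj hij => ?_,
    ⟨P.step' qLim', qLim', hP.step'_nonneg hq'0, hq'0, hs't, hq't,
      limsupLe_of_tendsto hs't (hev.mono fun i hi => (hbounds i hi).1),
      limsupLe_of_tendsto hq't (hev.mono fun i hi => (hbounds i hi).2.1),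
      limsupLe_of_tendsto (hs't.const_mul 2) (hev.mono fun i hi => (hbounds i hi).2.2)⟩,
    fun i j hi hj => ⟨?_, hcomp i j hi hj⟩, fun hqpos hd hunc => ?_⟩
  · rw [hP.sbar'_eq _ hi, hP.sbar'_eq _ hj]
    exact mul_le_mul_of_nonneg_left (hanti hij) hk.le
  · rw [hP.sbar'_eq _ hi, hP.sbar_eq hj]
    exact mul_le_mul_of_nonneg_left (hcomp i j hi hj) hk.le
  · have hmono := hP.step'_strictMono (Trajectory.norm_Jhat_pos_or hP hX) hunc
    have hlt1 : P.k⁻¹ * P.step' qLim < qLim := by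
      calc P.k⁻¹ * P.step' qLim < P.k⁻¹ * P.step qLim := by
            gcongr; exact hP.step'_lt_step (by rw [hsLim]; positivity) hd
        _ = qLim := hfix
    have hstrict : StrictAnti (P.qbar' qLim) :=
      recursion_strictAnti (f := fun x => P.k⁻¹ * P.step' x)
        (fun _ hx => mul_nonneg (inv_nonneg.2 hk.le) (hP.step'_nonneg hx))
        (fun x hx y hy hxy => mul_lt_mul_of_pos_left (hmono hx hy hxy) (inv_pos.2 hk))
        (fun _ => rfl) hq0 hlt1
    have hlt2 : ∀ i, 1 ≤ i → P.qbar' qLim i < qLim := fun _ hi => hstrict hi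
    refine ⟨hstrict, fun i hi j hj hij => ?_, fun i j hi hj => ⟨?_, hlt2 i hi, ?_,
      (hlt2 i hi).trans_le (hqle j)⟩⟩
    · rw [hP.sbar'_eq _ hi, hP.sbar'_eq _ hj]
      exact mul_lt_mul_of_pos_left (hstrict hij) hk
    · rw [hP.sbar'_eq _ hi, hsLim]
      exact mul_lt_mul_of_pos_left (hlt2 i hi) hk
    · rw [hP.sbar'_eq _ hi, hP.sbar_eq hj]
      exact mul_lt_mul_of_pos_left ((hlt2 i hi).trans_le (hqle j)) hk
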